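/- Setting. Let $G=(V,E)$ be a connected undirected graph with $V=\{1,\dots,N\}$, let $A=\{1,\dots,K\}$ with $K\ge 2$, let $T\ge 1$, and let $\ell_t(i)\in[0,1]$ ($t\ge 1$, $i\in A$) be losses fixed in advance (oblivious adversary). Each agent $v\in V$ has a delay $d(v)\in\mathbb N$ and a time-to-live $ttl(v)\in\mathbb N$. The directed graph $G_{\mathcal P}$ on $V$ has the arc $(v',v)$ iff $\mathrm{dist}_G(v',v)\le\min\{d(v),ttl(v')\}$; $N^-_{\mathcal P}(v)=\{v' : (v',v)\text{ is an arc}\}\ni v$; $\alpha(G_{\mathcal P})$ is the independence number of $G_{\mathcal P}$ with orientations and self-loops disregarded; $\bar d_V=\frac1N\sum_{v\in V}d(v)$. Algorithm (Exp3-Coop2 with $\delta=1/T$ and the doubling trick). In round $t=1,\dots,T$ every agent $v$ draws $I_t(v)\in A$ from $\boldsymbol p_t(v)=(p_t(i,v))_{i\in A}$, independently of the other agents given the past, where $$p_t(i,v)=\frac{\widetilde p_t(i,v)}{\sum_{j\in A}\widetilde p_t(j,v)},\qquad \widetilde p_t(i,v)=\max\Bigl\{\frac{w_t(i,v)}{\sum_{j\in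 A} w_t(j,v)},\frac{\delta}{K}\Bigr\}.$$ Put $q_s(i,v)=1-\prod_{v'\in N^-_{\mathcal P}(v)}(1-p_s(i,v'))$ and let $B_s(i,v)\in\{0,1\}$ indicate that some $v'\in N^-_{\mathcal P}(v)$ has $I_s(v')=i$. Agent $v$ starts in stage $r_0(v)=\lceil\log_2\ln K+2\log_2(Ke(d(v)+1))\rceil$ with all weights equal to $1$; in stage $r$ it uses the learning rate $\eta_r(v)=\gamma_r(v)/(Ke(d(v)+1))$ with $\gamma_r(v)=Ke(d(v)+1)\sqrt{(\ln K)/2^r}$. At the end of round $t$, let $n$ be the number of rounds of $v$'s current stage so far, round $t$ included; if $n>d(v)$ put, with $s=t-d(v)$, $$\widehat\ell_t(i,v)=\frac{\ell_s(i)}{q_s(i,v)}B_s(i,v),\qquad Q_t(v)=d(v)+\frac e2\sum_{i\in A}\frac{p_s(i,v)}{q_s(i,v)},$$ and otherwise put $\widehat\ell_t(i,v)=Q_t(v)=0$. If the sum of the $Q$'s of the current stage (round $t$ included) exceeds $2^r$, then $v$ restarts in stage $r+1$, with all weights reset to $1$; otherwise $w_{t+1}(i,v)=p_t(i,v)\exp(-\eta_r(v)\widehat\ell_t(i,v))$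 for all $i\in A$. Claim. There are absolute constants $C>0$ and $m\in\mathbb N$ such that, for all $G,N,K,T,d,ttl$ and $\ell$ as above, the average welfare regret $$R_T^{\mathrm{coop}}=\frac1N\sum_{v\in V}\mathbb E\Bigl[\sum_{t=1}^T\ell_t(I_t(v))\Bigr]-\min_{i\in A}\sum_{t=1}^T\ell_t(i)$$ satisfies $$R_T^{\mathrm{coop}}\le C\Bigl(\sqrt{(\ln K)\bigl(\bar d_V+1+\tfrac KN\,\alpha(G_{\mathcal P})\ln(TNK)\bigr)T}+\bar d_V\bigl(\ln T+\ln\ln(TNK)\bigr)\Bigr)+C\Bigl(N+K+\sum_{v\in V}d(v)\Bigr)^m .$$ In particular, as $T$ grows large, $R_T^{\mathrm{coop}}=\mathcal O\Bigl(\sqrt{(\ln K)\bigl(\bar d_V+1+\tfrac KN\,\alpha(G_{\mathcal P})\ln(TNK)\bigr)T}+\bar d_V\bigl(\ln T+\ln\ln(TNK)\bigr)\Bigr)$ with an absolute constant. -/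

import Mathlib

noncomputable section

namespace ExpCoop

/-- The arc relation `(u, v) ∈ E_P` of the directed graph `G_P`: messages generated by `u` reach `v`
and are used by `v`, i.e. the shortest-path distance of `u` and `v` in `G` is at most
`min (d v) (ttl u)`. -/
def Arc {V : Type*} (G : SimpleGraph V) (d ttl : V → ℕ) (u v : V) : Prop :=
  G.edist u v ≤ ((min (d v) (ttl u) : ℕ) : ℕ∞)

open Classical in
/-- The in-neighborhood `N⁻_P(v)` of `v` in `G_P` (it contains `v`). -/
def inNbhd {V : Type*} [Fintype V] (G : SimpleGraph V) (d ttl : V → ℕ) (v : V) : Finset V :=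
  Finset.univ.filter (fun u => Arc G d ttl u v)

/-- The independence number `α(G_P)`: orientations (and self-loops) are disregarded. -/
def alphaP {V : Type*} [Fintype V] (G : SimpleGraph V) (d ttl : V → ℕ) : ℕ :=
  (SimpleGraph.fromRel (Arc G d ttl)).indepNum

/-- The clipped weights `p̃(i) = max {w(i) / W, δ / K}` with `W = ∑ j, w(j)`. -/
def clipped {K : ℕ} (δ : ℝ) (w : Fin K → ℝ) (i : Fin K) : ℝ :=
  max (w i / ∑ j, w j) (δ / K)

/-- The distribution `p(i) = p̃(i) / P̃` with `P̃ = ∑ j, p̃(j)` from which an agent with weights `w`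
draws its action. -/
def actionProb {K : ℕ} (δ : ℝ) (w : Fin K → ℝ) (i : Fin K) : ℝ :=
  clipped δ w i / ∑ j, clipped δ w j

/-- `q(i) = 1 - ∏ u ∈ S, (1 - p(i, u))`: the probability that some agent of `S` plays `i`, when the
agents draw their actions independently from the distributions `p u`. -/
def hitProb {V : Type*} {K : ℕ} (S : Finset V) (p : V → Fin K → ℝ) (i : Fin K) : ℝ :=
  1 - ∏ u ∈ S, (1 - p u i)

/-- The factor `K e (d + 1)`. -/
def scale (K d : ℕ) : ℝ := K * Real.exp 1 * (d + 1)

/-- The doubling-trick parameter `γ_r = K e (d + 1) √(ln K / 2 ^ r)` of an agent with delay `d`. -/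
def gammaStage (K d r : ℕ) : ℝ := scale K d * √(Real.log K / 2 ^ r)

/-- The learning rate `η = γ_r / (K e (d + 1))` used in stage `r` by an agent with delay `d`. -/
def etaStage (K d r : ℕ) : ℝ := gammaStage K d r / scale K d

/-- The first stage `r₀ = ⌈log₂ ln K + 2 log₂ (K e (d + 1))⌉` (which is positive for `2 ≤ K`). -/
def firstStage (K d : ℕ) : ℕ :=
  ⌈Real.logb 2 (Real.log K) + 2 * Real.logb 2 (scale K d)⌉₊

/-- What an agent remembers at the beginning of a round. -/
structure AgentState (K : ℕ) where
  /-- The weights `w(i)`. -/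
  weight : Fin K → ℝ
  /-- The current stage `r` of the doubling trick. -/
  stage : ℕ
  /-- The number of the present round, counted from `1` at the last restart. -/
  clock : ℕ
  /-- The sum of `Q_s` over the rounds `s` since the last restart, the present one excluded. -/
  total : ℝ

/-- The state in which an agent (re)starts the algorithm in stage `r`. -/
def AgentState.fresh (K r : ℕ) : AgentState K where
  weight := fun _ => 1
  stage := r
  clock := 1
  total := 0

/-- The importance-weighted loss estimate of an agent whose local clock is `clock`; `oldLoss`, `q`
and `hit` are the losses, the probabilities `q` and the events `B` of the round `d` rounds ago. -/
def lossEst {K : ℕ} (d clock : ℕ) (oldLoss q : Fin K → ℝ) (hit : Fin K → Prop)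
    (i : Fin K) : ℝ :=
  open Classical in
  if d < clock then oldLoss i / q i * (if hit i then 1 else 0) else 0

/-- The quantity `Q` of the doubling trick; `oldProb` and `q` are the agent's own distribution and
the probabilities `q` of the round `d` rounds ago. -/
def qTerm {K : ℕ} (d clock : ℕ) (oldProb q : Fin K → ℝ) : ℝ :=
  if d < clock then (d : ℝ) + Real.exp 1 / 2 * ∑ i, oldProb i / q i else 0

/-- The transition at the end of a round: if the sum of the `Q`'s since the last restart exceeds
`2 ^ r`, the agent restarts the algorithm in stage `r + 1`; otherwise it performs the exponential
update with the learning rate of stage `r`. Here `est` are the loss estimates and `Q` is the value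
of `Q` of the present round. -/
def AgentState.next {K : ℕ} (δ : ℝ) (d : ℕ) (s : AgentState K) (est : Fin K → ℝ) (Q : ℝ) :
    AgentState K :=
  open Classical in
  if (2 : ℝ) ^ s.stage < s.total + Q then
    AgentState.fresh K (s.stage + 1)
  else
    { weight := fun i => actionProb δ s.weight i * Real.exp (-(etaStage K d s.stage) * est i)
      stage := s.stage
      clock := s.clock + 1
      total := s.total + Q }

/-- `run G d ttl δ ℓ a t v` is the state of agent `v` at the beginning of round `t` when Exp3-Coop2
is run with exploration parameter `δ` on the losses `ℓ`, each agent tuning its learning rate by the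
doubling trick, and `a t v` is the action played by `v` in round `t`. Rounds are numbered
`0, …, T - 1`. The state at the beginning of round `t` depends on the actions of earlier rounds
only, and `t - d v` below is used only when `d v < clock ≤ t + 1`, so it is not truncated. -/
def run {V : Type*} [Fintype V] {K T : ℕ} (G : SimpleGraph V) (d ttl : V → ℕ) (δ : ℝ)
    (ℓ : ℕ → Fin K → ℝ) (a : Fin T → V → Fin K) : ℕ → V → AgentState K
  | 0 => fun v => AgentState.fresh K (firstStage K (d v))
  | t + 1 => fun v =>
      let S := inNbhd G d ttl v
      let s := run G d ttl δ ℓ a t v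
      let p : V → Fin K → ℝ := fun u => actionProb δ (run G d ttl δ ℓ a (t - d v) u).weight
      let hit : Fin K → Prop := fun i => ∃ u ∈ S, ∃ h : t - d v < T, a ⟨t - d v, h⟩ u = i
      s.next δ (d v)
        (lossEst (d v) s.clock (ℓ (t - d v)) (hitProb S p) hit)
        (qTerm (d v) s.clock (p v) (hitProb S p))
  termination_by t => t
  decreasing_by all_goals omega

/-- `p_t(i, v)`, as a function of the actions `a` played. -/
def playProb {V : Type*} [Fintype V] {K T : ℕ} (G : SimpleGraph V) (d ttl : V → ℕ) (δ : ℝ)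
    (ℓ : ℕ → Fin K → ℝ) (a : Fin T → V → Fin K) (t : ℕ) (v : V) (i : Fin K) : ℝ :=
  actionProb δ (run G d ttl δ ℓ a t v).weight i

/-- The probability that the agents play exactly the actions `a` in the rounds `0, …, T - 1`: given
the past, the actions of round `t` are drawn independently, `a t v` from the distribution
`p_t(·, v)`. -/
def trajProb {V : Type*} [Fintype V] {K T : ℕ} (G : SimpleGraph V) (d ttl : V → ℕ) (δ : ℝ)
    (ℓ : ℕ → Fin K → ℝ) (a : Fin T → V → Fin K) : ℝ :=
  ∏ t : Fin T, ∏ v : V, playProb G d ttl δ ℓ a t v (a t v)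

open Classical in
/-- The expectation of `f` with respect to the internal randomization of the agents. -/
def expect {V : Type*} [Fintype V] {K T : ℕ} (G : SimpleGraph V) (d ttl : V → ℕ) (δ : ℝ)
    (ℓ : ℕ → Fin K → ℝ) (f : (Fin T → V → Fin K) → ℝ) : ℝ :=
  ∑ a : Fin T → V → Fin K, trajProb G d ttl δ ℓ a * f a

/-- The average welfare regret after `T` rounds of Exp3-Coop2 with doubling trick and exploration
parameter `δ`. -/
def welfareRegret {V : Type*} [Fintype V] {K : ℕ} (G : SimpleGraph V) (d ttl : V → ℕ) (δ : ℝ)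
    (ℓ : ℕ → Fin K → ℝ) (T : ℕ) : ℝ :=
  (1 / (Fintype.card V : ℝ)) *
      ∑ v : V, expect G d ttl δ ℓ (fun a : Fin T → V → Fin K => ∑ t : Fin T, ℓ t (a t v))
    - ⨅ i : Fin K, ∑ t : Fin T, ℓ t i

/-- The average delay `d̄_V`. -/
def meanDelay {V : Type*} [Fintype V] (d : V → ℕ) : ℝ :=
  (1 / (Fintype.card V : ℝ)) * ∑ v : V, (d v : ℝ)

end ExpCoop

end

/-!
For one agent, exponential weights with the estimates `ℓ̂` have regret at most `ln K / η` plus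
`η / 2` times the sum of `∑ i, p_t(i) ℓ̂_t(i)²`. The learning rate is small enough for the
probabilities to grow by at most a factor `e` during `d` rounds, so that `p_t` may be compared with
the probabilities `q_{t-d}` entering the estimates, and the conditional expectation of the quadratic
term is at most `e ∑ i, p_{t-d}(i) / q_{t-d}(i)`. Comparing `p_t` with `p_{t-d}` in the opposite
direction costs `d` times the total drift of the probabilities, about `d η` per round. Both costs
are thus covered by `η` times the quantities `Q` which the doubling trick sums, and since the stage
scales `√(ln K · 2 ^ r)` grow geometrically, the regret is bounded by a multiple of the scale of the
last stage, plus the `d + 1` rounds without usable estimates lost in each of the `O(ln T)` stages.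

The threshold `2 ^ r` of the last stage is at most `2 ^ r₀` plus twice the total sum of the `Q`.
The sum of `p(i, v) / q(i, v)` over the agents is controlled by the graph: since
`q(i, v) ≥ 1 - exp (-∑ p(i, u)) ≥ min {1, ∑ p(i, u)} / 2` with `u` ranging over the in-neighbors of
`v`, a weighted Caro–Wei bound and the Cauchy–Schwarz inequality give a multiple of
`∑ v, p(i, v) + α(G_P) ln (T N K)`. Averaging over the agents by the AM–GM inequality concludes.
-/

namespace ExpCoop

section IndependenceNumber

variable {V : Type*}

open scoped Classical in
/-- The `p`-weight of the in-neighborhood of `v`, within the vertex set `W`, in the digraph `R`. -/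
noncomputable def inWeight (R : V → V → Prop) (p : V → ℝ) (W : Finset V) (v : V) : ℝ :=
  ∑ u ∈ W with R u v, p u

lemma inWeight_pos {R : V → V → Prop} (hR : ∀ v, R v v) {p : V → ℝ} (hp : ∀ v, 0 < p v)
    {W : Finset V} {v : V} (hv : v ∈ W) : 0 < inWeight R p W v :=
  Finset.sum_pos (fun u _ => hp u) ⟨v, by simp [hv, hR]⟩

open scoped Classical in
lemma inWeight_mono (R : V → V → Prop) {p : V → ℝ} (hp : ∀ v, 0 ≤ p v) {W W' : Finset V}
    (hWW' : W ⊆ W') (v : V) : inWeight R p W v ≤ inWeight R p W' v :=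
  Finset.sum_le_sum_of_subset_of_nonneg (Finset.filter_subset_filter _ hWW') fun u _ _ => hp u

lemma sum_mul_inWeight_flip (R : V → V → Prop) (p : V → ℝ) (W : Finset V) :
    ∑ v ∈ W, p v * inWeight (flip R) p W v = ∑ v ∈ W, p v * inWeight R p W v := by
  simp only [inWeight, Finset.mul_sum, Finset.sum_filter]
  rw [Finset.sum_comm]
  exact Finset.sum_congr rfl fun u _ => Finset.sum_congr rfl fun v _ => by
    rw [mul_ite, mul_ite, mul_zero, mul_zero, mul_comm (p u)]; rfl

lemma inWeight_or_le {R R' : V → V → Prop} {p : V → ℝ} (hp : ∀ v, 0 ≤ p v) (W : Finset V) (v : V) :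
    inWeight (fun u v => R u v ∨ R' u v) p W v ≤ inWeight R p W v + inWeight R' p W v := by
  simp only [inWeight, Finset.sum_filter, ← Finset.sum_add_distrib]
  refine Finset.sum_le_sum fun u _ => ?_
  have := hp u
  by_cases h : R u v <;> by_cases h' : R' u v <;> simp [h, h', this]

/-- A weighted Caro–Wei bound. Greedily pick the vertex of least closed-neighborhood weight and
delete its closed neighborhood, which contributes at most `1` to the sum. -/
lemma exists_isIndepSet_sum_div_inWeight_le_card (H : SimpleGraph V) {p : V → ℝ}
    (hp : ∀ v, 0 < p v) (W : Finset V) :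
    ∃ I ⊆ W, H.IsIndepSet (I : Set V) ∧
      ∑ v ∈ W, p v / inWeight (fun u v => u = v ∨ H.Adj u v) p W v ≤ I.card := by
  classical
  set R : V → V → Prop := fun u v => u = v ∨ H.Adj u v
  have hR : ∀ v, R v v := fun v => Or.inl rfl
  induction W using Finset.strongInduction with
  | H W ih =>
  rcases W.eq_empty_or_nonempty with rfl | hW
  · exact ⟨∅, by simp⟩
  obtain ⟨v, hvW, hv⟩ := W.exists_min_image (inWeight R p W) hW
  set W' := W.filter fun u => ¬ R u v
  have hss : W' ⊂ W := Finset.filter_ssubset.2 ⟨v, hvW, not_not.2 (hR v)⟩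
  obtain ⟨I, hIW, hI, hle⟩ := ih W' hss
  have hnadj : ∀ u ∈ I, ¬ R u v := fun u hu => (Finset.mem_filter.1 (hIW hu)).2
  refine ⟨insert v I, Finset.insert_subset hvW (hIW.trans hss.subset), ?_, ?_⟩
  · rw [Finset.coe_insert]
    exact Set.Pairwise.insert hI fun u hu _ =>
      ⟨fun h => hnadj u hu (Or.inr h.symm), fun h => hnadj u hu (Or.inr h)⟩
  have hnear : ∑ u ∈ W with R u v, p u / inWeight R p W u ≤ 1 := by
    calc ∑ u ∈ W with R u v, p u / inWeight R p W u
        ≤ ∑ u ∈ W with R u v, p u / inWeight R p W v :=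
          Finset.sum_le_sum fun u hu => div_le_div_of_nonneg_left (hp u).le
            (inWeight_pos hR hp hvW) (hv u (Finset.mem_filter.1 hu).1)
      _ = 1 := by
          rw [← Finset.sum_div]
          exact (congrArg₂ _ (by simp only [inWeight]; congr!) rfl).trans
            (div_self (inWeight_pos hR hp hvW).ne')
  have hfar : ∑ u ∈ W', p u / inWeight R p W u ≤ I.card :=
    (Finset.sum_le_sum fun u hu => div_le_div_of_nonneg_left (hp u).le
      (inWeight_pos hR hp hu) (inWeight_mono R (fun x => (hp x).le) hss.subset u)).trans hle
  rw [Finset.card_insert_of_notMem fun h => hnadj v h (hR v),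
    ← Finset.sum_filter_add_sum_filter_not W (fun u => R u v)]
  push_cast
  linarith

lemma sum_mul_inWeight_fromRel_le {R : V → V → Prop} (hR : ∀ v, R v v) {p : V → ℝ}
    (hp : ∀ v, 0 ≤ p v) (W : Finset V) :
    ∑ v ∈ W, p v * inWeight (fun u v => u = v ∨ (SimpleGraph.fromRel R).Adj u v) p W v ≤
      2 * ∑ v ∈ W, p v * inWeight R p W v := by
  have hAdj : (fun u v => u = v ∨ (SimpleGraph.fromRel R).Adj u v) =
      fun u v => R u v ∨ flip R u v := by
    funext u v
    by_cases huv : u = v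
    · simp [huv, hR]
    · simp [huv, flip]
  calc ∑ v ∈ W, p v * inWeight (fun u v => u = v ∨ (SimpleGraph.fromRel R).Adj u v) p W v
      ≤ ∑ v ∈ W, p v * (inWeight R p W v + inWeight (flip R) p W v) := by
        rw [hAdj]
        exact Finset.sum_le_sum fun v _ =>
          mul_le_mul_of_nonneg_left (inWeight_or_le hp W v) (hp v)
    _ = 2 * ∑ v ∈ W, p v * inWeight R p W v := by
        simp only [mul_add, Finset.sum_add_distrib, sum_mul_inWeight_flip]
        ring

variable [Finite V]

lemma sq_sum_le_indepNum_mul_sum (H : SimpleGraph V) {p : V → ℝ} (hp : ∀ v, 0 < p v)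
    (W : Finset V) :
    (∑ v ∈ W, p v) ^ 2 ≤
      H.indepNum * ∑ v ∈ W, p v * inWeight (fun u v => u = v ∨ H.Adj u v) p W v := by
  have := Fintype.ofFinite V
  set S := inWeight (fun u v => u = v ∨ H.Adj u v) p W
  have hS : ∀ v ∈ W, 0 < S v := fun v hv =>
    inWeight_pos (R := fun u v => u = v ∨ H.Adj u v) (fun v => Or.inl rfl) hp hv
  have hpS : ∀ v ∈ W, 0 ≤ p v * S v := fun v hv => (mul_pos (hp v) (hS v hv)).le
  obtain ⟨I, -, hI, hle⟩ := exists_isIndepSet_sum_div_inWeight_le_card H hp W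
  have hIα : (I.card : ℝ) ≤ H.indepNum := by exact_mod_cast hI.card_le_indepNum
  calc (∑ v ∈ W, p v) ^ 2 ≤ (∑ v ∈ W, p v / S v) * ∑ v ∈ W, p v * S v :=
        Finset.sum_sq_le_sum_mul_sum_of_sq_le_mul W
          (fun v hv => (div_pos (hp v) (hS v hv)).le) hpS
          (fun v hv => by have := (hS v hv).ne'; exact le_of_eq (by field_simp))
    _ ≤ H.indepNum * ∑ v ∈ W, p v * S v :=
        mul_le_mul_of_nonneg_right (hle.trans hIα) (Finset.sum_nonneg hpS)

lemma exists_sum_le_indepNum_mul_inWeight {R : V → V → Prop} (hR : ∀ v, R v v) {p : V → ℝ}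
    (hp : ∀ v, 0 < p v) {W : Finset V} (hW : W.Nonempty) :
    ∃ v ∈ W, ∑ u ∈ W, p u ≤ 2 * (SimpleGraph.fromRel R).indepNum * inWeight R p W v := by
  set α : ℝ := ((SimpleGraph.fromRel R).indepNum : ℝ)
  by_contra! hlt
  have hsq : (∑ v ∈ W, p v) ^ 2 ≤ α * (2 * ∑ v ∈ W, p v * inWeight R p W v) :=
    (sq_sum_le_indepNum_mul_sum _ hp W).trans (mul_le_mul_of_nonneg_left
      (sum_mul_inWeight_fromRel_le hR (fun v => (hp v).le) W) (Nat.cast_nonneg _))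
  have hsum : ∑ v ∈ W, p v * (2 * α * inWeight R p W v) < ∑ v ∈ W, p v * ∑ u ∈ W, p u :=
    Finset.sum_lt_sum_of_nonempty hW fun v hv => mul_lt_mul_of_pos_left (hlt v hv) (hp v)
  rw [← Finset.sum_mul, ← sq] at hsum
  refine hsum.not_ge (hsq.trans (le_of_eq ?_))
  rw [Finset.mul_sum, Finset.mul_sum]
  exact Finset.sum_congr rfl fun v _ => by ring

lemma div_add_log_div_le {x y β : ℝ} (hx : 0 < x) (hy : 0 < y) (hβ : 0 < β) :
    x / (x + y) + Real.log (y / β) ≤ Real.log ((x + y) / β) := by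
  have hxy : 0 < x + y := add_pos hx hy
  have hlog := Real.log_le_sub_one_of_pos (div_pos hy hxy)
  have hdiv : x / (x + y) = 1 - y / (x + y) := by field_simp; ring
  rw [Real.log_div hy.ne' hxy.ne'] at hlog
  rw [Real.log_div hxy.ne' hβ.ne', Real.log_div hy.ne' hβ.ne']
  linarith

/-- Remove the vertex of large in-weight found above: its own term is at most `2 α p(v) / p(W)`,
and `p(v) / p(W) ≤ ln p(W) - ln p(W ∖ {v})` makes the sum over all removals telescope. -/
lemma sum_div_inWeight_le {R : V → V → Prop} (hR : ∀ v, R v v) {p : V → ℝ} {β : ℝ} (hβ : 0 < β)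
    (hp : ∀ v, β ≤ p v) {W : Finset V} (hW : W.Nonempty) :
    ∑ v ∈ W, p v / inWeight R p W v ≤
      2 * (SimpleGraph.fromRel R).indepNum * (1 + Real.log ((∑ v ∈ W, p v) / β)) := by
  classical
  have hp0 : ∀ v, 0 < p v := fun v => hβ.trans_le (hp v)
  induction W using Finset.strongInduction with
  | H W ih =>
  obtain ⟨v, hv, hle⟩ := exists_sum_le_indepNum_mul_inWeight hR hp0 hW
  set α : ℝ := ((SimpleGraph.fromRel R).indepNum : ℝ)
  have : 0 ≤ α := Nat.cast_nonneg _
  set P := ∑ u ∈ W, p u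
  have hP : 0 < P := Finset.sum_pos (fun u _ => hp0 u) hW
  have hterm : p v / inWeight R p W v ≤ 2 * α * (p v / P) := by
    rw [div_le_iff₀ (inWeight_pos hR hp0 hv), mul_right_comm, mul_div_left_comm,
      le_mul_iff_one_le_right (hp0 v), one_le_div hP]
    exact hle
  rw [← Finset.add_sum_erase W _ hv]
  have hP_erase : p v + ∑ u ∈ W.erase v, p u = P := Finset.add_sum_erase W p hv
  rcases (W.erase v).eq_empty_or_nonempty with he | hne
  · rw [he, Finset.sum_empty, add_zero] at hP_erase ⊢
    refine hterm.trans (mul_le_mul_of_nonneg_left ?_ (by positivity))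
    rw [← hP_erase, div_self (hp0 v).ne']
    linarith [Real.log_nonneg ((one_le_div hβ).2 (hp v))]
  set P' := ∑ u ∈ W.erase v, p u
  have hP' : 0 < P' := Finset.sum_pos (fun u _ => hp0 u) hne
  have hrest : ∑ x ∈ W.erase v, p x / inWeight R p W x ≤ 2 * α * (1 + Real.log (P' / β)) :=
    (Finset.sum_le_sum fun x hx => div_le_div_of_nonneg_left (hp0 x).le (inWeight_pos hR hp0 hx)
      (inWeight_mono R (fun u => (hp0 u).le) (Finset.erase_subset v W) x)).trans
      (ih _ (Finset.erase_ssubset hv) hne)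
  have htelescope : p v / P + Real.log (P' / β) ≤ Real.log (P / β) := by
    rw [← hP_erase]
    exact div_add_log_div_le (hp0 v) hP' hβ
  have := mul_le_mul_of_nonneg_left htelescope (by positivity : 0 ≤ 2 * α)
  linarith

end IndependenceNumber

section HitProb

lemma le_hitProb {V : Type*} {K : ℕ} {S : Finset V} {p : V → Fin K → ℝ} {i : Fin K}
    (hp0 : ∀ u, 0 ≤ p u i) (hp1 : ∀ u, p u i ≤ 1) {v : V} (hv : v ∈ S) : p v i ≤ hitProb S p i := by
  classical
  rw [hitProb, ← Finset.mul_prod_erase _ _ hv, le_sub_comm]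
  exact mul_le_of_le_one_right (sub_nonneg.2 (hp1 v))
    (Finset.prod_le_one (fun u _ => sub_nonneg.2 (hp1 u)) fun u _ => sub_le_self _ (hp0 u))

lemma one_sub_exp_neg_sum_le_hitProb {V : Type*} {K : ℕ} (S : Finset V) {p : V → Fin K → ℝ}
    {i : Fin K} (hp : ∀ u, p u i ≤ 1) : 1 - Real.exp (-∑ u ∈ S, p u i) ≤ hitProb S p i := by
  rw [hitProb, ← Finset.sum_neg_distrib, Real.exp_sum]
  exact sub_le_sub_left (Finset.prod_le_prod (fun u _ => sub_nonneg.2 (hp u))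
    fun u _ => Real.one_sub_le_exp_neg (p u i)) 1

lemma half_min_le_one_sub_exp_neg {x : ℝ} (hx : 0 ≤ x) : min x 1 / 2 ≤ 1 - Real.exp (-x) := by
  set y := min x 1
  have hy0 : 0 ≤ y := le_min hx zero_le_one
  have hy1 : y ≤ 1 := min_le_right x 1
  have hmono : Real.exp (-x) ≤ Real.exp (-y) :=
    Real.exp_le_exp.2 (neg_le_neg (min_le_left x 1))
  have hinv : Real.exp (-y) * (1 + y) ≤ 1 := by
    rw [Real.exp_neg, inv_mul_le_iff₀ (Real.exp_pos y), mul_one]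
    linarith [Real.add_one_le_exp y]
  nlinarith [Real.exp_pos (-y)]

lemma div_hitProb_le {V : Type*} {K : ℕ} {S : Finset V} {p : V → Fin K → ℝ} {i : Fin K}
    (hp0 : ∀ u, 0 < p u i) (hp1 : ∀ u, p u i ≤ 1) {v : V} (hv : v ∈ S) :
    p v i / hitProb S p i ≤ 2 * p v i + 2 * (p v i / ∑ u ∈ S, p u i) := by
  set x := ∑ u ∈ S, p u i
  have hx : 0 < x := Finset.sum_pos (fun u _ => hp0 u) ⟨v, hv⟩
  have hpv := hp0 v
  calc p v i / hitProb S p i ≤ p v i / (min x 1 / 2) :=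
        div_le_div_of_nonneg_left hpv.le (half_pos (lt_min hx one_pos))
          ((half_min_le_one_sub_exp_neg hx.le).trans (one_sub_exp_neg_sum_le_hitProb S hp1))
    _ = 2 * (p v i / min x 1) := by field_simp
    _ ≤ 2 * p v i + 2 * (p v i / x) := by
        have : 0 < p v i / x := div_pos hpv hx
        rcases min_choice x 1 with h | h <;> rw [h] <;> linarith

lemma arc_refl {V : Type*} (G : SimpleGraph V) (d ttl : V → ℕ) (v : V) : Arc G d ttl v v := by
  simp [Arc]

variable {V : Type*} [Fintype V]

lemma mem_inNbhd_self (G : SimpleGraph V) (d ttl : V → ℕ) (v : V) : v ∈ inNbhd G d ttl v := by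
  simp [inNbhd, arc_refl]

lemma sum_div_hitProb_le [Nonempty V] {K : ℕ} (G : SimpleGraph V) (d ttl : V → ℕ)
    {p : V → Fin K → ℝ} {i : Fin K} {β : ℝ} (hβ : 0 < β) (hp : ∀ v, β ≤ p v i)
    (hp1 : ∀ v, p v i ≤ 1) :
    ∑ v, p v i / hitProb (inNbhd G d ttl v) p i ≤
      2 * ∑ v, p v i + 4 * alphaP G d ttl * (1 + Real.log (Fintype.card V / β)) := by
  have hp0 : ∀ v, 0 < p v i := fun v => hβ.trans_le (hp v)
  have hlog : Real.log ((∑ v, p v i) / β) ≤ Real.log (Fintype.card V / β) := by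
    have hcard : ∑ v, p v i ≤ Fintype.card V := by
      simpa using Finset.sum_le_sum fun v (_ : v ∈ Finset.univ) => hp1 v
    have hsum : 0 < ∑ v, p v i := Finset.sum_pos (fun v _ => hp0 v) Finset.univ_nonempty
    gcongr
  calc ∑ v, p v i / hitProb (inNbhd G d ttl v) p i
      ≤ ∑ v, (2 * p v i + 2 * (p v i / inWeight (Arc G d ttl) (p · i) Finset.univ v)) :=
        Finset.sum_le_sum fun v _ => div_hitProb_le hp0 hp1 (mem_inNbhd_self G d ttl v)
    _ = 2 * ∑ v, p v i + 2 * ∑ v, p v i / inWeight (Arc G d ttl) (p · i) Finset.univ v := by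
        rw [Finset.sum_add_distrib, Finset.mul_sum, Finset.mul_sum]
    _ ≤ 2 * ∑ v, p v i +
          2 * (2 * alphaP G d ttl * (1 + Real.log ((∑ v, p v i) / β))) := by
        gcongr
        exact sum_div_inWeight_le (arc_refl G d ttl) hβ hp Finset.univ_nonempty
    _ ≤ 2 * ∑ v, p v i + 4 * alphaP G d ttl * (1 + Real.log (Fintype.card V / β)) := by
        have := mul_le_mul_of_nonneg_left hlog (Nat.cast_nonneg (α := ℝ) (alphaP G d ttl))
        linarith

end HitProb

section Trajectories

lemma sum_sum_update {ι B M : Type*} [Fintype ι] [DecidableEq ι] [Fintype B] [AddCommMonoid M]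
    (s : ι) (H : (ι → B) → M) :
    ∑ a : ι → B, ∑ b, H (Function.update a s b) = Fintype.card B • ∑ a : ι → B, H a := by
  have hinv : Function.Involutive
      (fun x : (ι → B) × B => (Function.update x.1 s x.2, x.1 s)) := fun ⟨a, b⟩ => by simp
  rw [← Fintype.sum_prod_type' (f := fun a b => H (Function.update a s b)),
    hinv.bijective.sum_comp (fun x : (ι → B) × B => H x.1), Fintype.sum_prod_type,
    Finset.smul_sum]
  simp

variable {B R : Type*} {T : ℕ}

/-- The product of the first `n` factors of `∏ t, π t a (a t)`. -/
def prefixWeight [CommMonoid R] (π : Fin T → (Fin T → B) → B → R) (n : ℕ) (a : Fin T → B) : R :=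
  ∏ t ∈ Finset.univ.filter fun t : Fin T => (t : ℕ) < n, π t a (a t)

lemma prefixWeight_zero [CommMonoid R] (π : Fin T → (Fin T → B) → B → R) (a : Fin T → B) :
    prefixWeight π 0 a = 1 := by
  simp [prefixWeight]

lemma prefixWeight_eq_prod [CommMonoid R] (π : Fin T → (Fin T → B) → B → R) (a : Fin T → B) :
    prefixWeight π T a = ∏ t, π t a (a t) := by
  simp [prefixWeight]

lemma prefixWeight_succ [CommMonoid R] (π : Fin T → (Fin T → B) → B → R) (s : Fin T)
    (a : Fin T → B) : prefixWeight π (s + 1) a = π s a (a s) * prefixWeight π s a := by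
  have hinsert : (Finset.univ.filter fun t : Fin T => (t : ℕ) < s + 1) =
      insert s (Finset.univ.filter fun t : Fin T => (t : ℕ) < s) := by
    ext t
    simp only [Finset.mem_filter, Finset.mem_univ, true_and, Finset.mem_insert, Fin.ext_iff]
    omega
  rw [prefixWeight, hinsert]
  exact Finset.prod_insert (by simp)

/-- Probabilities `π t a b` of choosing `b` in round `t` of the trajectory `a`. They are given as
functions of the whole trajectory, so that nonanticipation becomes the field `dependsOn`. -/
structure IsPolicy [Fintype B] [CommSemiring R] (π : Fin T → (Fin T → B) → B → R) : Prop where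
  dependsOn : ∀ t b, DependsOn (fun a => π t a b) {τ : Fin T | (τ : ℕ) < t}
  sum_eq_one : ∀ t a, ∑ b, π t a b = 1

namespace IsPolicy

variable [Fintype B] {π : Fin T → (Fin T → B) → B → R}

lemma dependsOn_prefixWeight [CommSemiring R] (hπ : IsPolicy π) (n : ℕ) :
    DependsOn (prefixWeight π n) {τ : Fin T | (τ : ℕ) < n} := by
  intro a a' h
  refine Finset.prod_congr rfl fun t ht => ?_
  have ht' : (t : ℕ) < n := (Finset.mem_filter.1 ht).2
  rw [h t ht']
  exact hπ.dependsOn t (a' t) fun τ hτ => h τ (lt_trans hτ ht')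

lemma card_mul_sum_prefixWeight_succ [CommSemiring R] (hπ : IsPolicy π) (s : Fin T)
    {f : (Fin T → B) → B → R} (hf : ∀ b, DependsOn (f · b) {τ : Fin T | (τ : ℕ) < s}) :
    Fintype.card B * ∑ a, prefixWeight π (s + 1) a * f a (a s) =
      ∑ a, prefixWeight π s a * ∑ b, π s a b * f a b := by
  rw [← nsmul_eq_mul, ← sum_sum_update s]
  refine Finset.sum_congr rfl fun a _ => ?_
  rw [Finset.mul_sum]
  refine Finset.sum_congr rfl fun b _ => ?_
  have hpast : ∀ τ ∈ {τ : Fin T | (τ : ℕ) < s}, Function.update a s b τ = a τ := fun τ hτ =>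
    Function.update_of_ne (Fin.ne_of_lt hτ) _ _
  have hπ_past : π s (Function.update a s b) b = π s a b := hπ.dependsOn s b hpast
  have hf_past : f (Function.update a s b) b = f a b := hf b hpast
  rw [prefixWeight_succ, hπ.dependsOn_prefixWeight s hpast, Function.update_self, hπ_past,
    hf_past]
  ring

lemma sum_prefixWeight_mul [CommSemiring R] (hπ : IsPolicy π) {n m : ℕ} (hnm : n + m = T)
    {F : (Fin T → B) → R} (hF : DependsOn F {τ : Fin T | (τ : ℕ) < n}) :
    ∑ a, prefixWeight π n a * F a =
      (Fintype.card B : R) ^ m * ∑ a, (∏ t, π t a (a t)) * F a := by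
  induction m generalizing n with
  | zero =>
    obtain rfl : n = T := hnm
    simp only [prefixWeight_eq_prod, pow_zero, one_mul]
  | succ m ih =>
    have hstep := hπ.card_mul_sum_prefixWeight_succ ⟨n, by omega⟩ (f := fun a _ => F a)
      fun _ => hF
    simp only [← Finset.sum_mul, hπ.sum_eq_one, one_mul] at hstep
    have hF' : DependsOn F {τ : Fin T | (τ : ℕ) < n + 1} := fun a a' h =>
      hF fun τ hτ => h τ (Nat.lt_succ_of_lt hτ)
    rw [← hstep, ih (by omega) hF', pow_succ']
    ring

variable [Nonempty B] [Field R] [CharZero R]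

lemma sum_prod_eq_one (hπ : IsPolicy π) : ∑ a, ∏ t, π t a (a t) = 1 := by
  have h := hπ.sum_prefixWeight_mul (zero_add T) (F := fun _ => 1) fun _ _ _ => rfl
  simp only [prefixWeight_zero, mul_one, Finset.sum_const, Finset.card_univ, Fintype.card_fun,
    Fintype.card_fin, nsmul_eq_mul, Nat.cast_pow] at h
  exact (mul_eq_left₀ (pow_ne_zero T (Nat.cast_ne_zero.2 Fintype.card_ne_zero))).1 h.symm

lemma sum_prod_mul_eq (hπ : IsPolicy π) (s : Fin T) {f : (Fin T → B) → B → R}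
    (hf : ∀ b, DependsOn (f · b) {τ : Fin T | (τ : ℕ) < s}) :
    ∑ a, (∏ t, π t a (a t)) * f a (a s) =
      ∑ a, (∏ t, π t a (a t)) * ∑ b, π s a b * f a b := by
  have hplayed : DependsOn (fun a => f a (a s)) {τ : Fin T | (τ : ℕ) < s + 1} := fun a a' h => by
    have hs : a s = a' s := h s (Nat.lt_succ_self _)
    simp only [hs]
    exact hf (a' s) fun τ hτ => h τ (Nat.lt_succ_of_lt hτ)
  have hmean : DependsOn (fun a => ∑ b, π s a b * f a b) {τ : Fin T | (τ : ℕ) < s} :=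
    fun a a' h => Finset.sum_congr rfl fun b _ =>
      congrArg₂ (· * ·) (hπ.dependsOn s b h) (hf b h)
  have h := hπ.card_mul_sum_prefixWeight_succ s hf
  rw [hπ.sum_prefixWeight_mul (m := T - (s + 1)) (by omega) hplayed,
    hπ.sum_prefixWeight_mul (m := T - (s + 1) + 1) (by omega) hmean, ← mul_assoc,
    ← pow_succ'] at h
  exact mul_left_cancel₀ (pow_ne_zero _ (Nat.cast_ne_zero.2 Fintype.card_ne_zero)) h

end IsPolicy

end Trajectories

section ProductDistribution

variable {V : Type*} [Fintype V] [DecidableEq V]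

section

variable {I R : Type*} [Fintype I] [CommSemiring R] {p : V → I → R}

lemma sum_prod_mul_prod (p g : V → I → R) :
    ∑ b : V → I, (∏ v, p v (b v)) * ∏ v, g v (b v) = ∏ v, ∑ i, p v i * g v i := by
  rw [Fintype.prod_sum]
  simp only [Finset.prod_mul_distrib]

lemma sum_prod_apply (hp : ∀ v, ∑ i, p v i = 1) : ∑ b : V → I, ∏ v, p v (b v) = 1 := by
  simpa [hp] using sum_prod_mul_prod p fun _ _ => 1

lemma sum_prod_mul_apply (hp : ∀ v, ∑ i, p v i = 1) (v : V) (x : I → R) :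
    ∑ b : V → I, (∏ u, p u (b u)) * x (b v) = ∑ i, p v i * x i := by
  calc ∑ b : V → I, (∏ u, p u (b u)) * x (b v)
      = ∑ b : V → I, (∏ u, p u (b u)) * ∏ u, if u = v then x (b u) else 1 := by
        simp only [Fintype.prod_ite_eq']
    _ = ∏ u, ∑ i, p u i * if u = v then x i else 1 :=
        sum_prod_mul_prod p fun u i => if u = v then x i else 1
    _ = ∏ u, if u = v then ∑ i, p u i * x i else 1 := by
        refine Finset.prod_congr rfl fun u _ => ?_
        split_ifs <;> simp [hp]
    _ = ∑ i, p v i * x i := Fintype.prod_ite_eq' v _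

end

open scoped Classical in
lemma sum_prod_mul_ite_hit {K : ℕ} {p : V → Fin K → ℝ} (hp : ∀ v, ∑ i, p v i = 1)
    (S : Finset V) (i : Fin K) :
    ∑ b : V → Fin K, (∏ u, p u (b u)) * (if ∃ u ∈ S, b u = i then 1 else 0) = hitProb S p i := by
  have hmiss : ∀ b : V → Fin K, (if ∃ u ∈ S, b u = i then (1 : ℝ) else 0) =
      1 - ∏ u, if u ∈ S ∧ b u = i then 0 else 1 := by
    intro b
    split_ifs with h
    · obtain ⟨u, hu⟩ := h
      rw [Finset.prod_eq_zero (Finset.mem_univ u) (by rw [if_pos hu]), sub_zero]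
    · rw [Finset.prod_eq_one fun u _ => if_neg fun hu => h ⟨u, hu⟩, sub_self]
  have hfactor : ∀ u, ∑ j, p u j * (if u ∈ S ∧ j = i then 0 else 1) =
      if u ∈ S then 1 - p u i else 1 := by
    intro u
    by_cases hu : u ∈ S
    · have hsplit : ∀ j, p u j * (if u ∈ S ∧ j = i then 0 else 1) =
          p u j - if j = i then p u j else 0 := fun j => by split_ifs <;> simp_all
      simp only [hsplit, Finset.sum_sub_distrib, hp, Finset.sum_ite_eq', Finset.mem_univ,
        if_true, if_pos hu]
    · simp [hu, hp]
  simp only [hmiss, mul_sub, mul_one, Finset.sum_sub_distrib, sum_prod_apply hp]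
  rw [sum_prod_mul_prod p fun u j => if u ∈ S ∧ j = i then 0 else 1, hitProb]
  simp only [hfactor, Fintype.prod_ite_mem]

end ProductDistribution

section ActionProb

variable {K : ℕ} {δ : ℝ} {w : Fin K → ℝ}

lemma clipped_pos (hδ : 0 < δ) (hK : 0 < K) (w : Fin K → ℝ) (i : Fin K) : 0 < clipped δ w i :=
  lt_max_of_lt_right (by positivity)

lemma sum_clipped_pos (hδ : 0 < δ) (hK : 0 < K) (w : Fin K → ℝ) : 0 < ∑ i, clipped δ w i :=
  Finset.sum_pos (fun i _ => clipped_pos hδ hK w i) ⟨⟨0, hK⟩, Finset.mem_univ _⟩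

lemma actionProb_pos (hδ : 0 < δ) (hK : 0 < K) (w : Fin K → ℝ) (i : Fin K) :
    0 < actionProb δ w i :=
  div_pos (clipped_pos hδ hK w i) (sum_clipped_pos hδ hK w)

lemma sum_actionProb (hδ : 0 < δ) (hK : 0 < K) (w : Fin K → ℝ) : ∑ i, actionProb δ w i = 1 := by
  unfold actionProb
  rw [← Finset.sum_div, div_self (sum_clipped_pos hδ hK w).ne']

lemma actionProb_le_one (hδ : 0 < δ) (hK : 0 < K) (w : Fin K → ℝ) (i : Fin K) :
    actionProb δ w i ≤ 1 := by
  rw [← sum_actionProb hδ hK w]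
  exact Finset.single_le_sum (fun j _ => (actionProb_pos hδ hK w j).le) (Finset.mem_univ i)

lemma sum_clipped_le (hδ : 0 < δ) (hK : 0 < K) (hw : ∀ i, 0 ≤ w i) :
    ∑ i, clipped δ w i ≤ 1 + δ := by
  have hW : 0 ≤ ∑ j, w j := Finset.sum_nonneg fun j _ => hw j
  calc ∑ i, clipped δ w i ≤ ∑ i, (w i / ∑ j, w j + δ / K) :=
        Finset.sum_le_sum fun i _ => max_le_add_of_nonneg (div_nonneg (hw i) hW) (by positivity)
    _ = (∑ j, w j) / (∑ j, w j) + δ := by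
        rw [Finset.sum_add_distrib, ← Finset.sum_div]
        simp only [Finset.sum_const, Finset.card_univ, Fintype.card_fin, nsmul_eq_mul]
        field_simp
    _ ≤ 1 + δ := by gcongr; exact div_self_le_one _

lemma one_le_sum_clipped (hw : 0 < ∑ j, w j) : 1 ≤ ∑ i, clipped δ w i := by
  calc (1 : ℝ) = ∑ i, w i / ∑ j, w j := by rw [← Finset.sum_div, div_self hw.ne']
    _ ≤ _ := Finset.sum_le_sum fun i _ => le_max_left _ _

lemma clipped_div_le_actionProb (hδ : 0 < δ) (hK : 0 < K) (hw : ∀ i, 0 ≤ w i) (i : Fin K) :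
    clipped δ w i / (1 + δ) ≤ actionProb δ w i :=
  div_le_div_of_nonneg_left (clipped_pos hδ hK w i).le (sum_clipped_pos hδ hK w)
    (sum_clipped_le hδ hK hw)

lemma actionProb_le_clipped (hδ : 0 < δ) (hK : 0 < K) (hw : 0 < ∑ j, w j) (i : Fin K) :
    actionProb δ w i ≤ clipped δ w i :=
  div_le_self (clipped_pos hδ hK w i).le (one_le_sum_clipped hw)

lemma le_actionProb (hδ : 0 < δ) (hδ1 : δ ≤ 1) (hK : 0 < K) (hw : ∀ i, 0 ≤ w i) (i : Fin K) :
    δ / (2 * K) ≤ actionProb δ w i := by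
  refine le_trans ?_ (clipped_div_le_actionProb hδ hK hw i)
  rw [mul_comm, ← div_div]
  exact div_le_div₀ (clipped_pos hδ hK w i).le (le_max_right _ _) (by linarith) (by linarith)

lemma actionProb_const_one (hK : 0 < K) (hδ1 : δ ≤ 1) (i : Fin K) :
    actionProb δ (fun _ : Fin K => (1 : ℝ)) i = 1 / K := by
  have : (0 : ℝ) < K := by exact_mod_cast hK
  have : ∀ i, clipped δ (fun _ : Fin K => (1 : ℝ)) i = 1 / K := fun i => by
    simp only [clipped, Finset.sum_const, Finset.card_univ, Fintype.card_fin, nsmul_eq_mul, mul_one]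
    exact max_eq_left (by gcongr)
  simp only [actionProb, this, Finset.sum_const, Finset.card_univ, Fintype.card_fin, nsmul_eq_mul]
  field_simp

end ActionProb

section Run

lemma lossEst_congr_hit {K d clock : ℕ} (x q : Fin K → ℝ) {hit hit' : Fin K → Prop}
    (h : d < clock → hit = hit') : lossEst d clock x q hit = lossEst d clock x q hit' := by
  by_cases hd : d < clock
  · rw [h hd]
  · unfold lossEst
    simp only [hd, if_false]

variable {V : Type*} [Fintype V] {K T : ℕ} (G : SimpleGraph V) (d ttl : V → ℕ) (δ : ℝ)
  (ℓ : ℕ → Fin K → ℝ)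

/-- The event `B_s(i, v)` that some in-neighbor of `v` plays `i` in round `s`. -/
def Hit (a : Fin T → V → Fin K) (s : ℕ) (v : V) (i : Fin K) : Prop :=
  ∃ u ∈ inNbhd G d ttl v, ∃ h : s < T, a ⟨s, h⟩ u = i

/-- The probability `q_s(i, v)`, as a function of the actions `a` played. -/
noncomputable def qProb (a : Fin T → V → Fin K) (s : ℕ) (v : V) (i : Fin K) : ℝ :=
  hitProb (inNbhd G d ttl v) (playProb G d ttl δ ℓ a s) i

/-- The loss estimates `ℓ̂_t(·, v)` of agent `v` at the end of round `t`. -/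
noncomputable def estAt (a : Fin T → V → Fin K) (t : ℕ) (v : V) : Fin K → ℝ :=
  lossEst (d v) (run G d ttl δ ℓ a t v).clock (ℓ (t - d v)) (qProb G d ttl δ ℓ a (t - d v) v)
    (Hit G d ttl a (t - d v) v)

/-- The quantity `Q_t(v)` of the doubling trick, as a function of the actions `a` played. -/
noncomputable def qAt (a : Fin T → V → Fin K) (t : ℕ) (v : V) : ℝ :=
  qTerm (d v) (run G d ttl δ ℓ a t v).clock (playProb G d ttl δ ℓ a (t - d v) v)
    (qProb G d ttl δ ℓ a (t - d v) v)

lemma run_zero (a : Fin T → V → Fin K) (v : V) :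
    run G d ttl δ ℓ a 0 v = AgentState.fresh K (firstStage K (d v)) := by
  rw [run]

lemma run_succ (a : Fin T → V → Fin K) (t : ℕ) (v : V) :
    run G d ttl δ ℓ a (t + 1) v = (run G d ttl δ ℓ a t v).next δ (d v)
      (estAt G d ttl δ ℓ a t v) (qAt G d ttl δ ℓ a t v) := by
  rw [run]
  rfl

lemma clock_le (a : Fin T → V → Fin K) (t : ℕ) (v : V) :
    (run G d ttl δ ℓ a t v).clock ≤ t + 1 := by
  induction t with
  | zero => rw [run_zero]; rfl
  | succ t ih =>
    rw [run_succ, AgentState.next]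
    split_ifs
    · simp [AgentState.fresh]
    · simpa using ih

lemma dependsOn_hit (s : ℕ) (v : V) :
    DependsOn (fun a : Fin T → V → Fin K => Hit G d ttl a s v) {τ : Fin T | (τ : ℕ) ≤ s} := by
  intro a a' h
  have hs : ∀ hsT : s < T, a ⟨s, hsT⟩ = a' ⟨s, hsT⟩ := fun hsT => h ⟨s, hsT⟩ (le_refl s)
  funext i
  simp only [Hit, hs]

variable {G d ttl δ ℓ} in
lemma estAt_congr {a a' : Fin T → V → Fin K} {t : ℕ} {v : V}
    (hrun : run G d ttl δ ℓ a t v = run G d ttl δ ℓ a' t v)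
    (hplay : playProb G d ttl δ ℓ a (t - d v) = playProb G d ttl δ ℓ a' (t - d v))
    (hpast : ∀ τ : Fin T, (τ : ℕ) + d v ≤ t → a τ = a' τ) :
    estAt G d ttl δ ℓ a t v = estAt G d ttl δ ℓ a' t v := by
  unfold estAt qProb
  rw [hrun, hplay]
  refine lossEst_congr_hit _ _ fun hclock => ?_
  have hdt : d v < t + 1 := hclock.trans_le (clock_le G d ttl δ ℓ a' t v)
  exact dependsOn_hit G d ttl (t - d v) v fun τ (hτ : (τ : ℕ) ≤ t - d v) =>
    hpast τ (by omega)

lemma dependsOn_run (t : ℕ) (v : V) : DependsOn (fun a : Fin T → V → Fin K =>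
    run G d ttl δ ℓ a t v) {τ : Fin T | (τ : ℕ) + d v < t} := by
  induction t using Nat.strong_induction_on generalizing v with
  | _ t ih =>
  intro a a' h
  rcases t with _ | t
  · simp only [run_zero]
  have hpast : ∀ τ : Fin T, (τ : ℕ) + d v ≤ t → a τ = a' τ := fun τ hτ =>
    h τ (Nat.lt_succ_of_le hτ)
  have hrun : run G d ttl δ ℓ a t v = run G d ttl δ ℓ a' t v :=
    ih t (Nat.lt_succ_self t) v fun τ hτ => hpast τ (le_of_lt hτ)
  have hplay : playProb G d ttl δ ℓ a (t - d v) = playProb G d ttl δ ℓ a' (t - d v) := by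
    funext u i
    have hu : run G d ttl δ ℓ a (t - d v) u = run G d ttl δ ℓ a' (t - d v) u :=
      ih (t - d v) (by omega) u fun τ (hτ : (τ : ℕ) + d u < t - d v) => hpast τ (by omega)
    simp only [playProb, hu]
  have hq : qAt G d ttl δ ℓ a t v = qAt G d ttl δ ℓ a' t v := by
    unfold qAt qProb
    rw [hrun, hplay]
  simp only [run_succ]
  rw [hrun, hq, estAt_congr hrun hplay hpast]

lemma dependsOn_run_sub (t : ℕ) (v : V) : DependsOn (fun a : Fin T → V → Fin K =>
    run G d ttl δ ℓ a t v) {τ : Fin T | (τ : ℕ) < t - d v} :=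
  (dependsOn_run G d ttl δ ℓ t v).mono fun _ hτ => Nat.lt_sub_of_add_lt hτ

lemma dependsOn_playProb (t : ℕ) : DependsOn (fun a : Fin T → V → Fin K =>
    playProb G d ttl δ ℓ a t) {τ : Fin T | (τ : ℕ) < t} := fun a a' h => by
  funext v i
  have hrun : run G d ttl δ ℓ a t v = run G d ttl δ ℓ a' t v :=
    dependsOn_run G d ttl δ ℓ t v fun τ hτ => h τ ((Nat.le_add_right _ _).trans_lt hτ)
  simp only [playProb, hrun]

lemma dependsOn_qProb (t : ℕ) (v : V) : DependsOn (fun a : Fin T → V → Fin K =>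
    qProb G d ttl δ ℓ a t v) {τ : Fin T | (τ : ℕ) < t} := fun a a' h => by
  have hplay : playProb G d ttl δ ℓ a t = playProb G d ttl δ ℓ a' t :=
    dependsOn_playProb G d ttl δ ℓ t h
  funext i
  simp only [qProb, hplay]

lemma dependsOn_qAt (t : ℕ) (v : V) : DependsOn (fun a : Fin T → V → Fin K =>
    qAt G d ttl δ ℓ a t v) {τ : Fin T | (τ : ℕ) < t - d v} := fun a a' h => by
  have hrun : run G d ttl δ ℓ a t v = run G d ttl δ ℓ a' t v :=
    dependsOn_run_sub G d ttl δ ℓ t v h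
  have hplay : playProb G d ttl δ ℓ a (t - d v) = playProb G d ttl δ ℓ a' (t - d v) :=
    dependsOn_playProb G d ttl δ ℓ (t - d v) h
  have hq : qProb G d ttl δ ℓ a (t - d v) v = qProb G d ttl δ ℓ a' (t - d v) v :=
    dependsOn_qProb G d ttl δ ℓ (t - d v) v h
  simp only [qAt, hrun, hplay, hq]

end Run

section Expect

variable {V : Type*} [Fintype V] {K T : ℕ} {G : SimpleGraph V} {d ttl : V → ℕ} {δ : ℝ}
  {ℓ : ℕ → Fin K → ℝ}

lemma expect_add (f g : (Fin T → V → Fin K) → ℝ) :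
    expect G d ttl δ ℓ (fun a => f a + g a) = expect G d ttl δ ℓ f + expect G d ttl δ ℓ g := by
  simp only [expect, mul_add, Finset.sum_add_distrib]

lemma expect_sub (f g : (Fin T → V → Fin K) → ℝ) :
    expect G d ttl δ ℓ (fun a => f a - g a) = expect G d ttl δ ℓ f - expect G d ttl δ ℓ g := by
  simp only [expect, mul_sub, Finset.sum_sub_distrib]

lemma expect_const_mul (c : ℝ) (f : (Fin T → V → Fin K) → ℝ) :
    expect G d ttl δ ℓ (fun a => c * f a) = c * expect G d ttl δ ℓ f := by
  simp only [expect, Finset.mul_sum, mul_left_comm]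

lemma expect_sum {ι : Type*} (s : Finset ι) (f : ι → (Fin T → V → Fin K) → ℝ) :
    expect G d ttl δ ℓ (fun a => ∑ i ∈ s, f i a) = ∑ i ∈ s, expect G d ttl δ ℓ (f i) := by
  simp only [expect, Finset.mul_sum]
  exact Finset.sum_comm

lemma playProb_pos (hδ : 0 < δ) (hK : 0 < K) (a : Fin T → V → Fin K) (t : ℕ) (v : V)
    (i : Fin K) : 0 < playProb G d ttl δ ℓ a t v i := actionProb_pos hδ hK _ i

lemma sum_playProb (hδ : 0 < δ) (hK : 0 < K) (a : Fin T → V → Fin K) (t : ℕ) (v : V) :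
    ∑ i, playProb G d ttl δ ℓ a t v i = 1 := sum_actionProb hδ hK _

lemma trajProb_nonneg (hδ : 0 < δ) (hK : 0 < K) (a : Fin T → V → Fin K) :
    0 ≤ trajProb G d ttl δ ℓ a :=
  Finset.prod_nonneg fun _ _ => Finset.prod_nonneg fun _ _ => (playProb_pos hδ hK _ _ _ _).le

lemma expect_mono (hδ : 0 < δ) (hK : 0 < K) {f g : (Fin T → V → Fin K) → ℝ}
    (h : ∀ a, f a ≤ g a) : expect G d ttl δ ℓ f ≤ expect G d ttl δ ℓ g :=
  Finset.sum_le_sum fun a _ => mul_le_mul_of_nonneg_left (h a) (trajProb_nonneg hδ hK a)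

open scoped Classical in
lemma isPolicy_prod_playProb (hδ : 0 < δ) (hK : 0 < K) :
    IsPolicy fun (t : Fin T) a (b : V → Fin K) => ∏ v, playProb G d ttl δ ℓ a t v (b v) where
  dependsOn t b a a' h := by
    have hplay : playProb G d ttl δ ℓ a t = playProb G d ttl δ ℓ a' t :=
      dependsOn_playProb G d ttl δ ℓ t h
    simp only [hplay]
  sum_eq_one t a := sum_prod_apply (sum_playProb hδ hK a t)

open scoped Classical in
lemma expect_resample (hδ : 0 < δ) (hK : 0 < K) (s : Fin T)
    {f : (Fin T → V → Fin K) → (V → Fin K) → ℝ}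
    (hf : ∀ b, DependsOn (f · b) {τ : Fin T | (τ : ℕ) < s}) :
    expect G d ttl δ ℓ (fun a => f a (a s)) = expect G d ttl δ ℓ (fun a =>
      ∑ b : V → Fin K, (∏ v, playProb G d ttl δ ℓ a s v (b v)) * f a b) :=
  have : NeZero K := ⟨hK.ne'⟩
  (isPolicy_prod_playProb hδ hK).sum_prod_mul_eq s hf

lemma expect_const (hδ : 0 < δ) (hK : 0 < K) (c : ℝ) :
    expect G d ttl δ ℓ (fun _ : Fin T → V → Fin K => c) = c := by
  classical
  have : NeZero K := ⟨hK.ne'⟩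
  simp only [expect, ← Finset.sum_mul, trajProb]
  rw [(isPolicy_prod_playProb hδ hK).sum_prod_eq_one, one_mul]

lemma expect_play (hδ : 0 < δ) (hK : 0 < K) (s : Fin T) (v : V) (x : Fin K → ℝ) :
    expect G d ttl δ ℓ (fun a => x (a s v)) =
      expect G d ttl δ ℓ (fun a : Fin T → V → Fin K =>
        ∑ i, playProb G d ttl δ ℓ a s v i * x i) := by
  classical
  rw [expect_resample hδ hK s (f := fun _ b => x (b v)) (fun _ _ _ _ => rfl)]
  simp only [sum_prod_mul_apply (sum_playProb hδ hK _ _)]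

open scoped Classical in
lemma expect_hit (hδ : 0 < δ) (hK : 0 < K) {s : ℕ} (hs : s < T) (v : V) (i : Fin K)
    {X : (Fin T → V → Fin K) → ℝ} (hX : DependsOn X {τ : Fin T | (τ : ℕ) < s}) :
    expect G d ttl δ ℓ (fun a => X a * if Hit G d ttl a s v i then 1 else 0) =
      expect G d ttl δ ℓ (fun a => X a * qProb G d ttl δ ℓ a s v i) := by
  simp only [Hit, hs, exists_true_left]
  rw [expect_resample hδ hK ⟨s, hs⟩
    (f := fun a b => X a * if ∃ u ∈ inNbhd G d ttl v, b u = i then 1 else 0)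
    (fun b a a' h => by simp only [hX h])]
  simp only [mul_left_comm _ (X _), ← Finset.mul_sum,
    sum_prod_mul_ite_hit (sum_playProb hδ hK _ _), qProb]

end Expect

section Rates

lemma le_two_pow_ceil_logb {x : ℝ} (hx : 0 < x) : x ≤ 2 ^ ⌈Real.logb 2 x⌉₊ := by
  rw [← Real.rpow_natCast, ← Real.logb_le_iff_le_rpow one_lt_two hx]
  exact Nat.le_ceil _

lemma two_pow_ceil_logb_le {x : ℝ} (hx : 1 ≤ x) : (2 : ℝ) ^ ⌈Real.logb 2 x⌉₊ ≤ 2 * x := by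
  rw [← Real.rpow_natCast, ← Real.le_logb_iff_rpow_le one_lt_two (by positivity),
    Real.logb_mul two_ne_zero (by positivity), Real.logb_self_eq_one one_lt_two, add_comm]
  exact (Nat.ceil_lt_add_one (Real.logb_nonneg one_lt_two hx)).le

/-- The regret scale `√(ln K · 2 ^ r)` of stage `r` of the doubling trick. -/
noncomputable def stageScale (K r : ℕ) : ℝ := √(Real.log K * 2 ^ r)

variable {K : ℕ} (hK : 2 ≤ K)
include hK

lemma half_le_log : 1 / 2 ≤ Real.log K := by
  have h2 : (2 : ℝ) ≤ K := by exact_mod_cast hK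
  linarith [Real.log_two_gt_d9, Real.log_le_log two_pos h2]

lemma stageScale_pos (r : ℕ) : 0 < stageScale K r := by
  have := half_le_log hK
  exact Real.sqrt_pos.2 (by positivity)

lemma stageScale_sq (r : ℕ) : stageScale K r ^ 2 = Real.log K * 2 ^ r := by
  have := half_le_log hK
  exact Real.sq_sqrt (by positivity)

lemma stageScale_mono : Monotone (stageScale K) := fun r s h => by
  have := half_le_log hK
  unfold stageScale
  gcongr
  exact one_le_two

lemma sum_stageScale_le (R : ℕ) :
    ∑ r ∈ Finset.range (R + 1), stageScale K r ≤ 4 * stageScale K R := by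
  induction R with
  | zero =>
    rw [zero_add, Finset.sum_range_one]
    linarith [stageScale_pos hK 0]
  | succ R ih =>
    have hpos := stageScale_pos hK (R + 1)
    have hratio : stageScale K R ≤ 3 / 4 * stageScale K (R + 1) := by
      refine (abs_le_of_sq_le_sq' ?_ (by positivity)).2
      have h0 := half_le_log hK
      have hpow : (0 : ℝ) < 2 ^ R := by positivity
      rw [mul_pow, stageScale_sq hK, stageScale_sq hK, pow_succ (2 : ℝ) R]
      nlinarith
    rw [Finset.sum_range_succ]
    linarith

lemma four_le_scale (d : ℕ) : 4 ≤ scale K d := by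
  have hK' : (2 : ℝ) ≤ K := by exact_mod_cast hK
  have he := Real.add_one_le_exp (1 : ℝ)
  have : (0 : ℝ) ≤ d := Nat.cast_nonneg d
  calc (4 : ℝ) = 2 * 2 * 1 := by norm_num
    _ ≤ K * Real.exp 1 * (d + 1) := by gcongr <;> linarith

lemma scale_pos (d : ℕ) : 0 < scale K d := by linarith [four_le_scale hK d]

lemma one_le_log_mul_scale (d : ℕ) : 1 ≤ Real.log K * scale K d := by
  have h1 := half_le_log hK
  have h2 := four_le_scale hK d
  nlinarith

lemma scale_le_log_mul_scale_sq (d : ℕ) : scale K d ≤ Real.log K * scale K d ^ 2 := by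
  have := mul_le_mul_of_nonneg_right (one_le_log_mul_scale hK d) (scale_pos hK d).le
  linarith

lemma etaStage_eq (d r : ℕ) : etaStage K d r = Real.log K / stageScale K r := by
  have h0 : 0 < Real.log K := by linarith [half_le_log hK]
  unfold etaStage gammaStage
  rw [mul_div_cancel_left₀ _ (scale_pos hK d).ne', eq_div_iff (stageScale_pos hK r).ne', stageScale,
    ← Real.sqrt_mul (by positivity), show Real.log K / 2 ^ r * (Real.log K * 2 ^ r)
      = Real.log K ^ 2 by field_simp, Real.sqrt_sq h0.le]

lemma etaStage_pos (d r : ℕ) : 0 < etaStage K d r := by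
  rw [etaStage_eq hK]
  exact div_pos (by linarith [half_le_log hK]) (stageScale_pos hK r)

lemma etaStage_mul_two_pow (d r : ℕ) : etaStage K d r * 2 ^ r = stageScale K r := by
  rw [etaStage_eq hK, div_mul_eq_mul_div, div_eq_iff (stageScale_pos hK r).ne',
    ← stageScale_sq hK r, sq]

lemma one_div_etaStage (d r : ℕ) : 1 / etaStage K d r = stageScale K r / Real.log K := by
  rw [etaStage_eq hK, one_div_div]

lemma firstStage_eq (d : ℕ) :
    firstStage K d = ⌈Real.logb 2 (Real.log K * scale K d ^ 2)⌉₊ := by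
  have h0 : Real.log K ≠ 0 := by linarith [half_le_log hK]
  rw [firstStage, Real.logb_mul h0 (pow_pos (scale_pos hK d) 2).ne', Real.logb_pow, Nat.cast_ofNat]

lemma le_two_pow_firstStage (d : ℕ) : Real.log K * scale K d ^ 2 ≤ 2 ^ firstStage K d := by
  rw [firstStage_eq hK]
  exact le_two_pow_ceil_logb ((scale_pos hK d).trans_le (scale_le_log_mul_scale_sq hK d))

lemma two_pow_firstStage_le (d : ℕ) :
    (2 : ℝ) ^ firstStage K d ≤ 2 * (Real.log K * scale K d ^ 2) := by
  rw [firstStage_eq hK]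
  exact two_pow_ceil_logb_le
    (by linarith [four_le_scale hK d, scale_le_log_mul_scale_sq hK d])

lemma etaStage_mul_scale_le (d : ℕ) {r : ℕ} (hr : firstStage K d ≤ r) :
    etaStage K d r * scale K d ≤ 1 := by
  have h0 := half_le_log hK
  have hpow := (le_two_pow_firstStage hK d).trans (pow_le_pow_right₀ one_le_two hr)
  rw [etaStage_eq hK, div_mul_eq_mul_div, div_le_one (stageScale_pos hK r)]
  refine Real.le_sqrt_of_sq_le ?_
  calc (Real.log K * scale K d) ^ 2 = Real.log K * (Real.log K * scale K d ^ 2) := by ring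
    _ ≤ Real.log K * 2 ^ r := by gcongr

end Rates

section ExponentialWeights

lemma exp_neg_le_quadratic {x : ℝ} (hx : 0 ≤ x) : Real.exp (-x) ≤ 1 - x + x ^ 2 / 2 := by
  have hquad : 0 ≤ 1 - x + x ^ 2 / 2 := by nlinarith [sq_nonneg (x - 1)]
  rw [Real.exp_neg, inv_le_iff_one_le_mul₀ (Real.exp_pos x)]
  calc (1 : ℝ) ≤ (1 - x + x ^ 2 / 2) * (1 + x + x ^ 2 / 2) := by nlinarith [sq_nonneg (x ^ 2)]
    _ ≤ (1 - x + x ^ 2 / 2) * Real.exp x := by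
      gcongr
      exact Real.quadratic_le_exp_of_nonneg hx

lemma log_sum_mul_exp_neg_le {ι : Type*} [Fintype ι] {p x : ι → ℝ} (hp : ∀ i, 0 ≤ p i)
    (hp1 : ∑ i, p i = 1) (hx : ∀ i, 0 ≤ x i) :
    Real.log (∑ i, p i * Real.exp (-x i)) ≤ -∑ i, p i * x i + (∑ i, p i * x i ^ 2) / 2 := by
  have hpos : 0 < ∑ i, p i * Real.exp (-x i) := by
    obtain ⟨i, hi, hne⟩ := Finset.exists_ne_zero_of_sum_ne_zero (hp1.trans_ne one_ne_zero)
    exact Finset.sum_pos' (fun j _ => mul_nonneg (hp j) (Real.exp_pos _).le)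
      ⟨i, hi, mul_pos ((hp i).lt_of_ne' hne) (Real.exp_pos _)⟩
  refine (Real.log_le_sub_one_of_pos hpos).trans (sub_le_iff_le_add.2 ?_)
  calc ∑ i, p i * Real.exp (-x i) ≤ ∑ i, p i * (1 - x i + x i ^ 2 / 2) :=
        Finset.sum_le_sum fun i _ => mul_le_mul_of_nonneg_left (exp_neg_le_quadratic (hx i)) (hp i)
    _ = ∑ i, (-(p i * x i) + p i * x i ^ 2 / 2 + p i) := Finset.sum_congr rfl fun i _ => by ring
    _ = -∑ i, p i * x i + (∑ i, p i * x i ^ 2) / 2 + 1 := by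
      rw [Finset.sum_add_distrib, Finset.sum_add_distrib, Finset.sum_neg_distrib,
        ← Finset.sum_div, hp1]

end ExponentialWeights

lemma le_pow_mul_of_succ_le {u : ℕ → ℝ} {c : ℝ} (hc : 0 ≤ c) (s j : ℕ)
    (h : ∀ t, s ≤ t → t < s + j → u (t + 1) ≤ c * u t) : u (s + j) ≤ c ^ j * u s := by
  induction j with
  | zero => simp
  | succ j ih =>
    rw [← add_assoc, pow_succ', mul_assoc]
    exact (h (s + j) (by omega) (by omega)).trans
      (mul_le_mul_of_nonneg_left (ih fun t h1 h2 => h t h1 (by omega)) hc)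

lemma sum_range_sum_Ico_le (n d : ℕ) {D : ℕ → ℝ} (hD : ∀ t, 0 ≤ D t) :
    ∑ t ∈ Finset.range n, ∑ s ∈ Finset.Ico (t - d) t, D s ≤ d * ∑ s ∈ Finset.range n, D s := by
  calc _ = ∑ s ∈ Finset.range n, ∑ _t ∈ Finset.range n with s < _t ∧ _t ≤ s + d, D s := by
        refine Finset.sum_comm' fun t s => ?_
        simp only [Finset.mem_range, Finset.mem_Ico, Finset.mem_filter]
        omega
    _ ≤ ∑ s ∈ Finset.range n, d * D s := by
        refine Finset.sum_le_sum fun s _ => ?_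
        have hsub : (Finset.range n).filter (fun t => s < t ∧ t ≤ s + d) ⊆
            Finset.Ioc s (s + d) := fun t ht =>
          Finset.mem_Ioc.2 (Finset.mem_filter.1 ht).2
        have hcard := Finset.card_le_card hsub
        rw [Nat.card_Ioc, Nat.add_sub_cancel_left] at hcard
        rw [Finset.sum_const, nsmul_eq_mul]
        exact mul_le_mul_of_nonneg_right (by exact_mod_cast hcard) (hD s)
    _ = _ := by rw [Finset.mul_sum]

/-- The evolution of the state of one agent with delay `d` that is driven by loss estimates `est`,
where `q s` stands for the importance weights of round `s` and `Q` for the quantities compared with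
the thresholds of the doubling trick. It abstracts `run` from the graph and the other agents. -/
structure AgentPath (K : ℕ) (δ : ℝ) (d : ℕ) where
  st : ℕ → AgentState K
  est : ℕ → Fin K → ℝ
  q : ℕ → Fin K → ℝ
  Q : ℕ → ℝ
  δ_pos : 0 < δ
  two_le_card : 2 ≤ K
  st_zero : st 0 = AgentState.fresh K (firstStage K d)
  st_succ : ∀ t, st (t + 1) = (st t).next δ d (est t) (Q t)
  Q_eq : ∀ t, Q t = qTerm d (st t).clock (actionProb δ (st (t - d)).weight) (q (t - d))
  est_eq_zero : ∀ t, (st t).clock ≤ d → ∀ i, est t i = 0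
  est_nonneg : ∀ t i, 0 ≤ est t i
  est_le : ∀ t i, est t i ≤ 1 / q (t - d) i
  prob_le : ∀ t i, actionProb δ (st t).weight i ≤ q t i

namespace AgentPath

variable {K d : ℕ} {δ : ℝ} (A : AgentPath K δ d)

/-- The distribution from which the agent draws its action in round `t`. -/
noncomputable def p (t : ℕ) (i : Fin K) : ℝ := actionProb δ (A.st t).weight i

/-- The learning rate in round `t`. -/
noncomputable def eta (t : ℕ) : ℝ := etaStage K d (A.st t).stage

/-- The event that the agent does not restart at the end of round `t`. -/
def Cont (t : ℕ) : Prop := (A.st t).total + A.Q t ≤ 2 ^ (A.st t).stage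

/-- The event that a loss estimate is received in round `t` and enters the weights of the next
round. -/
def Active (t : ℕ) : Prop := d < (A.st t).clock ∧ A.Cont t

section Stages

lemma st_succ_of_cont {t : ℕ} (h : A.Cont t) : A.st (t + 1) =
    { weight := fun i => A.p t i * Real.exp (-(A.eta t) * A.est t i)
      stage := (A.st t).stage
      clock := (A.st t).clock + 1
      total := (A.st t).total + A.Q t } := by
  rw [A.st_succ, AgentState.next, if_neg (not_lt.2 h)]
  rfl

lemma st_succ_of_not_cont {t : ℕ} (h : ¬ A.Cont t) :
    A.st (t + 1) = AgentState.fresh K ((A.st t).stage + 1) := by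
  rw [A.st_succ, AgentState.next, if_pos (not_le.1 h)]

lemma eta_succ_of_cont {t : ℕ} (h : A.Cont t) : A.eta (t + 1) = A.eta t := by
  unfold eta
  rw [A.st_succ_of_cont h]

lemma one_le_clock (t : ℕ) : 1 ≤ (A.st t).clock := by
  rcases t with _ | t
  · rw [A.st_zero, AgentState.fresh]
  · by_cases h : A.Cont t
    · simp only [A.st_succ_of_cont h, le_add_iff_nonneg_left, zero_le]
    · rw [A.st_succ_of_not_cont h, AgentState.fresh]

lemma clock_le (t : ℕ) : (A.st t).clock ≤ t + 1 := by
  induction t with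
  | zero => rw [A.st_zero, AgentState.fresh]
  | succ t ih =>
    by_cases h : A.Cont t
    · simpa only [A.st_succ_of_cont h, add_le_add_iff_right] using ih
    · simp only [A.st_succ_of_not_cont h, AgentState.fresh, le_add_iff_nonneg_left, zero_le]

lemma le_of_lt_clock {t : ℕ} (h : d < (A.st t).clock) : d ≤ t :=
  Nat.lt_succ_iff.1 (h.trans_le (A.clock_le t))

lemma stage_mono : Monotone fun t => (A.st t).stage := by
  refine monotone_nat_of_le_succ fun t => ?_
  by_cases h : A.Cont t
  · rw [A.st_succ_of_cont h]
  · rw [A.st_succ_of_not_cont h]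
    exact Nat.le_succ _

lemma firstStage_le (t : ℕ) : firstStage K d ≤ (A.st t).stage := by
  calc firstStage K d = (A.st 0).stage := by rw [A.st_zero, AgentState.fresh]
    _ ≤ (A.st t).stage := A.stage_mono (Nat.zero_le t)

lemma cont_of_lt_clock (s j : ℕ) (h : j < (A.st (s + j)).clock) :
    (∀ t, s ≤ t → t < s + j → A.Cont t) ∧ (A.st s).clock + j = (A.st (s + j)).clock := by
  induction j with
  | zero => exact ⟨fun t h1 h2 => absurd h2 (by omega), rfl⟩
  | succ j ih =>
    have hc : A.Cont (s + j) := by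
      by_contra hc
      rw [← add_assoc, A.st_succ_of_not_cont hc] at h
      simp [AgentState.fresh] at h
    rw [← add_assoc, A.st_succ_of_cont hc] at h ⊢
    simp only [add_lt_add_iff_right] at h
    obtain ⟨hcont, hclock⟩ := ih h
    refine ⟨fun t hs ht => ?_, by simp only; omega⟩
    rcases Nat.lt_succ_iff_lt_or_eq.1 ht with ht | rfl
    exacts [hcont t hs ht, hc]

lemma sum_shift_le_sum_range_sub {g : ℕ → ℝ} (hg : ∀ s, 0 ≤ g s) (n : ℕ) :
    ∑ t ∈ Finset.range n, (if d < (A.st t).clock then g (t - d) else 0) ≤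
      ∑ s ∈ Finset.range (n - d), g s := by
  induction n with
  | zero => simp
  | succ n ih =>
    rw [Finset.sum_range_succ]
    rcases Nat.lt_or_ge n d with h | h
    · have hclock : ¬ d < (A.st n).clock := fun hc => (A.le_of_lt_clock hc).not_gt h
      rw [if_neg hclock, add_zero, show n + 1 - d = 0 by omega]
      rwa [show n - d = 0 by omega] at ih
    · rw [show n + 1 - d = n - d + 1 by omega, Finset.sum_range_succ]
      refine add_le_add ih ?_
      split_ifs
      exacts [le_rfl, hg _]

lemma sum_shift_le {g : ℕ → ℝ} (hg : ∀ s, 0 ≤ g s) (n : ℕ) :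
    ∑ t ∈ Finset.range n, (if d < (A.st t).clock then g (t - d) else 0) ≤
      ∑ s ∈ Finset.range n, g s :=
  (A.sum_shift_le_sum_range_sub hg n).trans
    (Finset.sum_le_sum_of_subset_of_nonneg (Finset.range_mono (Nat.sub_le n d)) fun s _ _ => hg s)

open scoped Classical in
lemma card_inactive_le_add_min (n : ℕ) :
    ∑ t ∈ Finset.range n, (if A.Active t then (0 : ℝ) else 1) ≤
      (d + 1) * (((A.st n).stage : ℝ) - firstStage K d) + (min d ((A.st n).clock - 1) : ℕ) := by
  induction n with
  | zero => simp [A.st_zero, AgentState.fresh]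
  | succ n ih =>
    simp only [Active] at ih ⊢
    rw [Finset.sum_range_succ]
    by_cases h : A.Cont n
    · have hstep : (if d < (A.st n).clock then 0 else 1) + min d ((A.st n).clock - 1) ≤
          min d (A.st n).clock := by
        have := A.one_le_clock n
        split_ifs <;> omega
      have hstep' := Nat.cast_le (α := ℝ) |>.2 hstep
      push_cast at hstep'
      simp only [A.st_succ_of_cont h, h, and_true, Nat.add_sub_cancel, Nat.cast_min]
      rw [Nat.cast_min] at ih
      linarith
    · have hmin : ((min d ((A.st n).clock - 1) : ℕ) : ℝ) ≤ d := by exact_mod_cast min_le_left _ _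
      simp only [A.st_succ_of_not_cont h, h, and_false, if_false, AgentState.fresh, Nat.sub_self,
        Nat.min_zero, Nat.cast_zero, Nat.cast_succ]
      linarith

open scoped Classical in
lemma card_inactive_le (n : ℕ) :
    ∑ t ∈ Finset.range n, (if A.Active t then (0 : ℝ) else 1) ≤
      (d + 1) * (((A.st n).stage : ℝ) - firstStage K d + 1) := by
  have hmin : ((min d ((A.st n).clock - 1) : ℕ) : ℝ) ≤ d := by exact_mod_cast min_le_left _ _
  linarith [A.card_inactive_le_add_min n]

end Stages

section Positivity

include A in
lemma card_pos : 0 < K := two_pos.trans_le A.two_le_card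

lemma eta_pos (t : ℕ) : 0 < A.eta t := etaStage_pos A.two_le_card d _

lemma eta_mul_scale_le (t : ℕ) : A.eta t * scale K d ≤ 1 :=
  etaStage_mul_scale_le A.two_le_card d (A.firstStage_le t)

lemma eta_mul_est_nonneg (t : ℕ) (i : Fin K) : 0 ≤ A.eta t * A.est t i :=
  mul_nonneg (A.eta_pos t).le (A.est_nonneg t i)

lemma p_pos (t : ℕ) (i : Fin K) : 0 < A.p t i := actionProb_pos A.δ_pos A.card_pos _ i

lemma sum_p (t : ℕ) : ∑ i, A.p t i = 1 := sum_actionProb A.δ_pos A.card_pos _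

lemma p_le_one (t : ℕ) (i : Fin K) : A.p t i ≤ 1 := actionProb_le_one A.δ_pos A.card_pos _ i

lemma log_p_nonpos (t : ℕ) (i : Fin K) : 1 / A.eta t * Real.log (A.p t i) ≤ 0 :=
  mul_nonpos_of_nonneg_of_nonpos (one_div_pos.2 (A.eta_pos t)).le
    (Real.log_nonpos (A.p_pos t i).le (A.p_le_one t i))

lemma q_pos (t : ℕ) (i : Fin K) : 0 < A.q t i := (A.p_pos t i).trans_le (A.prob_le t i)

lemma sum_p_div_q_nonneg (t : ℕ) : 0 ≤ ∑ i, A.p t i / A.q t i :=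
  Finset.sum_nonneg fun i _ => (div_pos (A.p_pos t i) (A.q_pos t i)).le

lemma sum_p_div_q_le_card (t : ℕ) : ∑ i, A.p t i / A.q t i ≤ K := by
  calc ∑ i, A.p t i / A.q t i ≤ ∑ _i : Fin K, (1 : ℝ) :=
        Finset.sum_le_sum fun i _ => div_le_one_of_le₀ (A.prob_le t i) (A.q_pos t i).le
    _ = K := by simp

lemma weight_pos (t : ℕ) (i : Fin K) : 0 < (A.st t).weight i := by
  rcases t with _ | t
  · rw [A.st_zero]
    exact one_pos
  · by_cases h : A.Cont t
    · rw [A.st_succ_of_cont h]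
      exact mul_pos (A.p_pos t i) (Real.exp_pos _)
    · rw [A.st_succ_of_not_cont h]
      exact one_pos

lemma sum_weight_pos (t : ℕ) : 0 < ∑ i, (A.st t).weight i :=
  Finset.sum_pos (fun i _ => A.weight_pos t i) ⟨⟨0, A.card_pos⟩, Finset.mem_univ _⟩

lemma Q_nonneg (t : ℕ) : 0 ≤ A.Q t := by
  have := A.sum_p_div_q_nonneg (t - d)
  rw [A.Q_eq, qTerm]
  split_ifs
  · exact add_nonneg d.cast_nonneg (mul_nonneg (by positivity) this)
  · exact le_rfl

end Positivity

section Drift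

lemma weight_succ_le {t : ℕ} (h : A.Cont t) (i : Fin K) : (A.st (t + 1)).weight i ≤ A.p t i := by
  rw [A.st_succ_of_cont h]
  refine mul_le_of_le_one_right (A.p_pos t i).le ?_
  rw [Real.exp_le_one_iff, neg_mul, neg_nonpos]
  exact A.eta_mul_est_nonneg t i

lemma le_weight_succ {t : ℕ} (h : A.Cont t) (i : Fin K) :
    A.p t i * (1 - A.eta t * A.est t i) ≤ (A.st (t + 1)).weight i := by
  rw [A.st_succ_of_cont h]
  refine mul_le_mul_of_nonneg_left ?_ (A.p_pos t i).le
  linarith [Real.add_one_le_exp (-(A.eta t) * A.est t i)]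

lemma sum_weight_succ_le_one {t : ℕ} (h : A.Cont t) : ∑ i, (A.st (t + 1)).weight i ≤ 1 :=
  (Finset.sum_le_sum fun i _ => A.weight_succ_le h i).trans_eq (A.sum_p t)

lemma le_sum_weight_succ {t : ℕ} (h : A.Cont t) :
    1 - A.eta t * ∑ i, A.p t i * A.est t i ≤ ∑ i, (A.st (t + 1)).weight i := by
  calc 1 - A.eta t * ∑ i, A.p t i * A.est t i = ∑ i, A.p t i * (1 - A.eta t * A.est t i) := by
        rw [Finset.mul_sum]
        nth_rewrite 1 [← A.sum_p t]
        rw [← Finset.sum_sub_distrib]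
        exact Finset.sum_congr rfl fun i _ => by ring
    _ ≤ _ := Finset.sum_le_sum fun i _ => A.le_weight_succ h i

lemma normalized_weight_le (t : ℕ) (i : Fin K) :
    (A.st t).weight i / ∑ j, (A.st t).weight j ≤ A.p t i * (1 + δ) := by
  rw [← div_le_iff₀ (by linarith [A.δ_pos])]
  exact (div_le_div_of_nonneg_right (le_max_left _ _) (by linarith [A.δ_pos])).trans
    (clipped_div_le_actionProb A.δ_pos A.card_pos (fun j => (A.weight_pos t j).le) i)

lemma delta_div_card_le (t : ℕ) (i : Fin K) : δ / K ≤ A.p t i * (1 + δ) := by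
  rw [← div_le_iff₀ (by linarith [A.δ_pos])]
  exact (div_le_div_of_nonneg_right (le_max_right _ _) (by linarith [A.δ_pos])).trans
    (clipped_div_le_actionProb A.δ_pos A.card_pos (fun j => (A.weight_pos t j).le) i)

lemma p_mul_le_p_succ {t : ℕ} (h : A.Cont t) (i : Fin K) :
    A.p t i * (1 - A.eta t * A.est t i) ≤ A.p (t + 1) i * (1 + δ) := by
  refine (A.le_weight_succ h i).trans (le_trans ?_ (A.normalized_weight_le (t + 1) i))
  rw [le_div_iff₀ (A.sum_weight_pos (t + 1))]
  exact mul_le_of_le_one_right (A.weight_pos (t + 1) i).le (A.sum_weight_succ_le_one h)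

lemma p_sub_p_succ_le {t : ℕ} (h : A.Cont t) (i : Fin K) :
    A.p t i - A.p (t + 1) i ≤ A.p t i * (A.eta t * A.est t i + δ) := by
  have hp := A.p_pos t i
  have hδ := A.δ_pos
  have hx := A.eta_mul_est_nonneg t i
  have key : A.p t i * (1 - A.eta t * A.est t i - δ) * (1 + δ) ≤ A.p (t + 1) i * (1 + δ) := by
    refine le_trans ?_ (A.p_mul_le_p_succ h i)
    rw [mul_assoc]
    refine mul_le_mul_of_nonneg_left ?_ hp.le
    nlinarith
  linarith [le_of_mul_le_mul_right key (by linarith)]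

open scoped Classical in
lemma p_sub_p_add_le (s j : ℕ) (h : ∀ t, s ≤ t → t < s + j → A.Cont t) (i : Fin K) :
    A.p s i - A.p (s + j) i ≤ ∑ t ∈ Finset.Ico s (s + j),
      if A.Cont t then A.p t i * (A.eta t * A.est t i + δ) else 0 := by
  induction j with
  | zero => simp
  | succ j ih =>
    have hc := h (s + j) (by omega) (by omega)
    rw [← add_assoc, Finset.sum_Ico_succ_top (by omega), if_pos hc]
    linarith [A.p_sub_p_succ_le hc i, ih fun t h1 h2 => h t h1 (by omega)]

lemma sum_p_mul_est_le {t : ℕ} (hg : ∀ i, A.p t i ≤ Real.exp 1 * A.p (t - d) i) :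
    ∑ i, A.p t i * A.est t i ≤ K * Real.exp 1 := by
  calc ∑ i, A.p t i * A.est t i ≤ ∑ _i : Fin K, Real.exp 1 := Finset.sum_le_sum fun i _ => ?_
    _ = K * Real.exp 1 := by simp
  have hq := A.q_pos (t - d) i
  calc A.p t i * A.est t i ≤ (Real.exp 1 * A.q (t - d) i) * (1 / A.q (t - d) i) :=
        mul_le_mul ((hg i).trans (mul_le_mul_of_nonneg_left (A.prob_le _ i) (Real.exp_pos 1).le))
          (A.est_le t i) (A.est_nonneg t i) (by positivity)
    _ = Real.exp 1 := by field_simp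

lemma eta_mul_sum_p_mul_est_le {t : ℕ}
    (hg : d < (A.st t).clock → ∀ i, A.p t i ≤ Real.exp 1 * A.p (t - d) i) :
    A.eta t * ∑ i, A.p t i * A.est t i ≤ 1 / (d + 1) := by
  rcases le_or_gt (A.st t).clock d with hc | hc
  · simp only [A.est_eq_zero t hc, mul_zero, Finset.sum_const_zero]
    positivity
  · rw [le_div_iff₀ (by positivity)]
    have hη := A.eta_pos t
    calc A.eta t * (∑ i, A.p t i * A.est t i) * (d + 1)
        ≤ A.eta t * (K * Real.exp 1) * (d + 1) := by gcongr; exact A.sum_p_mul_est_le (hg hc)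
      _ = A.eta t * scale K d := by rw [scale]; ring
      _ ≤ 1 := A.eta_mul_scale_le t

lemma p_succ_le_of_growth (hδ : δ * d ≤ 1) (hd : 0 < d) {t : ℕ} (h : A.Cont t)
    (hg : d < (A.st t).clock → ∀ i, A.p t i ≤ Real.exp 1 * A.p (t - d) i) (i : Fin K) :
    A.p (t + 1) i ≤ Real.exp (1 / d) * A.p t i := by
  have hd' : (0 : ℝ) < d := by exact_mod_cast hd
  have hp := A.p_pos t i
  have hexp := Real.add_one_le_exp (1 / (d : ℝ))
  have hsum : (d : ℝ) / (d + 1) ≤ ∑ j, (A.st (t + 1)).weight j := by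
    calc (d : ℝ) / (d + 1) = 1 - 1 / (d + 1) := by field_simp; ring
      _ ≤ _ := by linarith [A.eta_mul_sum_p_mul_est_le hg, A.le_sum_weight_succ h]
  refine (actionProb_le_clipped A.δ_pos A.card_pos (A.sum_weight_pos (t + 1)) i).trans
    (max_le ?_ ?_)
  · calc _ ≤ A.p t i / (d / (d + 1)) :=
          div_le_div₀ hp.le (A.weight_succ_le h i) (by positivity) hsum
      _ = (1 / d + 1) * A.p t i := by field_simp; ring
      _ ≤ _ := by gcongr
  · have hδ' : δ ≤ 1 / d := by rwa [le_div_iff₀ hd']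
    calc δ / K ≤ A.p t i * (1 + δ) := A.delta_div_card_le t i
      _ ≤ _ := by
        rw [mul_comm]
        gcongr
        linarith

lemma p_le_exp_mul_of_growth (hd : 0 < d) {t : ℕ} (hc : d < (A.st t).clock)
    (hg : ∀ s < t, A.Cont s → ∀ i, A.p (s + 1) i ≤ Real.exp (1 / d) * A.p s i) (i : Fin K) :
    A.p t i ≤ Real.exp 1 * A.p (t - d) i := by
  obtain ⟨s, rfl⟩ := Nat.exists_eq_add_of_le' (A.le_of_lt_clock hc)
  have hcont := (A.cont_of_lt_clock s d hc).1
  have hpow := le_pow_mul_of_succ_le (u := fun t => A.p t i) (Real.exp_pos (1 / (d : ℝ))).le s d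
    fun t hs ht => hg t ht (hcont t hs ht) i
  rwa [← Real.exp_nat_mul, mul_one_div_cancel (by positivity), ← Nat.add_sub_cancel s d,
    Nat.sub_add_cancel (Nat.le_add_left d s)] at hpow

/-- Growth by `e ^ (1 / d)` per round compounds to the factor `e` over the delay, and this factor in
turn keeps the mass removed by the next update below `1 / (d + 1)`. -/
lemma p_succ_le (hδ : δ * d ≤ 1) (hd : 0 < d) (t : ℕ) (h : A.Cont t) :
    ∀ i, A.p (t + 1) i ≤ Real.exp (1 / d) * A.p t i := by
  induction t using Nat.strong_induction_on with
  | _ t ih => exact A.p_succ_le_of_growth hδ hd h fun hc => A.p_le_exp_mul_of_growth hd hc ih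

lemma p_le_exp_mul (hδ : δ * d ≤ 1) {t : ℕ} (hc : d < (A.st t).clock) (i : Fin K) :
    A.p t i ≤ Real.exp 1 * A.p (t - d) i := by
  rcases Nat.eq_zero_or_pos d with rfl | hd
  · exact le_mul_of_one_le_left (A.p_pos t i).le (Real.one_le_exp zero_le_one)
  · exact A.p_le_exp_mul_of_growth hd hc (fun s _ => A.p_succ_le hδ hd s) i

end Drift

section Regret

lemma log_p_succ_ge {t : ℕ} (h : A.Cont t) (k : Fin K) :
    Real.log (A.p t k) - A.eta t * A.est t k - Real.log (∑ j, (A.st (t + 1)).weight j) - δ ≤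
      Real.log (A.p (t + 1) k) := by
  have hδ := A.δ_pos
  have hp := A.p_pos t k
  have hw := A.weight_pos (t + 1) k
  have hW := A.sum_weight_pos (t + 1)
  have hlog := Real.log_le_log (by positivity) (A.normalized_weight_le (t + 1) k)
  have hlogw : Real.log ((A.st (t + 1)).weight k) =
      Real.log (A.p t k) - A.eta t * A.est t k := by
    simp only [A.st_succ_of_cont h]
    rw [Real.log_mul hp.ne' (Real.exp_pos _).ne', Real.log_exp, neg_mul, ← sub_eq_add_neg]
  rw [Real.log_mul (A.p_pos _ k).ne' (by positivity), Real.log_div hw.ne' hW.ne', hlogw] at hlog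
  linarith [Real.log_le_sub_one_of_pos (by linarith : 0 < 1 + δ)]

lemma log_sum_weight_succ_le {t : ℕ} (h : A.Cont t) :
    Real.log (∑ j, (A.st (t + 1)).weight j) ≤
      -(A.eta t * ∑ i, A.p t i * A.est t i) + A.eta t ^ 2 / 2 * ∑ i, A.p t i * A.est t i ^ 2 := by
  have hlog := log_sum_mul_exp_neg_le (fun i => (A.p_pos t i).le) (A.sum_p t)
    (A.eta_mul_est_nonneg t)
  have hlin : ∑ i, A.p t i * (A.eta t * A.est t i) = A.eta t * ∑ i, A.p t i * A.est t i := by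
    rw [Finset.mul_sum]
    exact Finset.sum_congr rfl fun i _ => by ring
  have hsq : (∑ i, A.p t i * (A.eta t * A.est t i) ^ 2) / 2 =
      A.eta t ^ 2 / 2 * ∑ i, A.p t i * A.est t i ^ 2 := by
    rw [Finset.mul_sum, Finset.sum_div]
    exact Finset.sum_congr rfl fun i _ => by ring
  rw [hlin, hsq] at hlog
  simpa only [A.st_succ_of_cont h, neg_mul] using hlog

lemma sum_p_mul_est_sub_le {t : ℕ} (h : A.Cont t) (k : Fin K) :
    ∑ i, A.p t i * A.est t i - A.est t k ≤
      1 / A.eta t * (Real.log (A.p (t + 1) k) - Real.log (A.p t k) + δ) +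
        A.eta t / 2 * ∑ i, A.p t i * A.est t i ^ 2 := by
  have hη := A.eta_pos t
  rw [← mul_le_mul_iff_right₀ hη]
  calc A.eta t * (∑ i, A.p t i * A.est t i - A.est t k)
      ≤ Real.log (A.p (t + 1) k) - Real.log (A.p t k) + δ
        + A.eta t ^ 2 / 2 * ∑ i, A.p t i * A.est t i ^ 2 := by
        linarith [A.log_p_succ_ge h k, A.log_sum_weight_succ_le h]
    _ = _ := by field_simp

lemma log_p_div_eta_of_fresh (hδ : δ ≤ 1) {t r : ℕ} (h : A.st t = AgentState.fresh K r)
    (k : Fin K) : 1 / A.eta t * Real.log (A.p t k) = -stageScale K r := by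
  have hl := half_le_log A.two_le_card
  have hp : A.p t k = 1 / K := by
    unfold p
    rw [h]
    exact actionProb_const_one A.card_pos hδ k
  rw [hp, one_div (K : ℝ), Real.log_inv, eta, one_div_etaStage A.two_le_card, h]
  simp only [AgentState.fresh]
  field_simp

open scoped Classical in
lemma sum_cont_le_potential (hδ : δ ≤ 1) (n : ℕ) (k : Fin K) :
    ∑ t ∈ Finset.range n, (if A.Cont t then ∑ i, A.p t i * A.est t i - A.est t k else 0) ≤
      1 / A.eta n * Real.log (A.p n k) + ∑ r ∈ Finset.range ((A.st n).stage + 1), stageScale K r +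
      δ * ∑ t ∈ Finset.range n, 1 / A.eta t +
      ∑ t ∈ Finset.range n,
        (if A.Cont t then A.eta t / 2 * ∑ i, A.p t i * A.est t i ^ 2 else 0) := by
  induction n with
  | zero =>
    have hsum : 0 ≤ ∑ r ∈ Finset.range (firstStage K d), stageScale K r :=
      Finset.sum_nonneg fun r _ => (stageScale_pos A.two_le_card r).le
    simp only [Finset.range_zero, Finset.sum_empty, mul_zero, add_zero]
    rw [A.log_p_div_eta_of_fresh hδ A.st_zero, A.st_zero]
    simp only [AgentState.fresh, Finset.sum_range_succ]
    linarith
  | succ n ih =>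
    simp only [Finset.sum_range_succ _ n]
    by_cases h : A.Cont n
    · have hstage : (A.st (n + 1)).stage = (A.st n).stage := by rw [A.st_succ_of_cont h]
      simp only [if_pos h, A.eta_succ_of_cont h, hstage]
      linarith [A.sum_p_mul_est_sub_le h k]
    · have hδη := mul_pos A.δ_pos (one_div_pos.2 (A.eta_pos n))
      have hlog := A.log_p_nonpos n k
      rw [A.log_p_div_eta_of_fresh hδ (A.st_succ_of_not_cont h), A.st_succ_of_not_cont h]
      simp only [if_neg h, add_zero, AgentState.fresh]
      rw [Finset.sum_range_succ _ ((A.st n).stage + 1)]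
      linarith

lemma one_div_eta_le {t n : ℕ} (h : t ≤ n) : 1 / A.eta t ≤ 2 * stageScale K (A.st n).stage := by
  have hl := half_le_log A.two_le_card
  have hpos := stageScale_pos A.two_le_card (A.st n).stage
  rw [eta, one_div_etaStage A.two_le_card, div_le_iff₀ (by linarith)]
  calc stageScale K (A.st t).stage ≤ stageScale K (A.st n).stage :=
        stageScale_mono A.two_le_card (A.stage_mono h)
    _ ≤ 2 * stageScale K (A.st n).stage * Real.log K := by nlinarith

open scoped Classical in
lemma sum_cont_le (hδ : δ ≤ 1) (n : ℕ) (hn : δ * n ≤ 1) (k : Fin K) :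
    ∑ t ∈ Finset.range n, (if A.Cont t then ∑ i, A.p t i * A.est t i - A.est t k else 0) ≤
      6 * stageScale K (A.st n).stage +
      ∑ t ∈ Finset.range n,
        (if A.Cont t then A.eta t / 2 * ∑ i, A.p t i * A.est t i ^ 2 else 0) := by
  have hexplore : δ * ∑ t ∈ Finset.range n, 1 / A.eta t ≤ 2 * stageScale K (A.st n).stage := by
    have hδ0 := A.δ_pos
    have hpos := stageScale_pos A.two_le_card (A.st n).stage
    calc δ * ∑ t ∈ Finset.range n, 1 / A.eta t
        ≤ δ * ∑ _t ∈ Finset.range n, 2 * stageScale K (A.st n).stage := by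
          gcongr with t ht
          exact A.one_div_eta_le (Finset.mem_range.1 ht).le
      _ = δ * n * (2 * stageScale K (A.st n).stage) := by
          rw [Finset.sum_const, Finset.card_range, nsmul_eq_mul, mul_assoc]
      _ ≤ 2 * stageScale K (A.st n).stage := mul_le_of_le_one_left (by positivity) hn
  linarith [A.sum_cont_le_potential hδ n k, A.log_p_nonpos n k,
    sum_stageScale_le A.two_le_card (A.st n).stage]

end Regret

section DoublingTrick

lemma total_le (t : ℕ) : (A.st t).total ≤ 2 ^ (A.st t).stage := by
  rcases t with _ | t
  · simp [A.st_zero, AgentState.fresh]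
  · by_cases h : A.Cont t
    · rw [A.st_succ_of_cont h]
      exact h
    · simp [A.st_succ_of_not_cont h, AgentState.fresh]

lemma eta_mul_total_le (t : ℕ) : A.eta t * (A.st t).total ≤ stageScale K (A.st t).stage := by
  rw [← etaStage_mul_two_pow A.two_le_card d]
  exact mul_le_mul_of_nonneg_left (A.total_le t) (A.eta_pos t).le

open scoped Classical in
lemma sum_eta_mul_Q_le_potential (n : ℕ) :
    ∑ t ∈ Finset.range n, (if A.Cont t then A.eta t * A.Q t else 0) ≤
      ∑ r ∈ Finset.range (A.st n).stage, stageScale K r + A.eta n * (A.st n).total := by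
  induction n with
  | zero =>
    rw [A.st_zero]
    simp only [Finset.range_zero, Finset.sum_empty, AgentState.fresh, mul_zero, add_zero]
    exact Finset.sum_nonneg fun r _ => (stageScale_pos A.two_le_card r).le
  | succ n ih =>
    rw [Finset.sum_range_succ]
    by_cases h : A.Cont n
    · rw [if_pos h, A.eta_succ_of_cont h, A.st_succ_of_cont h]
      linarith
    · rw [if_neg h, A.st_succ_of_not_cont h]
      simp only [AgentState.fresh, mul_zero, add_zero, Finset.sum_range_succ]
      linarith [A.eta_mul_total_le n]

open scoped Classical in
lemma sum_eta_mul_Q_le (n : ℕ) :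
    ∑ t ∈ Finset.range n, (if A.Cont t then A.eta t * A.Q t else 0) ≤
      4 * stageScale K (A.st n).stage := by
  have hsum := sum_stageScale_le A.two_le_card (A.st n).stage
  rw [Finset.sum_range_succ] at hsum
  linarith [A.sum_eta_mul_Q_le_potential n, A.eta_mul_total_le n]

lemma total_le_sum_Q (n : ℕ) : (A.st n).total ≤ ∑ t ∈ Finset.range n, A.Q t := by
  induction n with
  | zero => simp [A.st_zero, AgentState.fresh]
  | succ n ih =>
    by_cases h : A.Cont n
    · rw [A.st_succ_of_cont h, Finset.sum_range_succ]
      linarith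
    · rw [A.st_succ_of_not_cont h]
      exact Finset.sum_nonneg fun t _ => A.Q_nonneg t

lemma two_pow_stage_le (n : ℕ) : (2 : ℝ) ^ (A.st n).stage ≤
    max (2 ^ firstStage K d) (2 * ∑ t ∈ Finset.range n, A.Q t) := by
  induction n with
  | zero =>
    rw [A.st_zero, AgentState.fresh]
    exact le_max_left _ _
  | succ n ih =>
    rw [Finset.sum_range_succ]
    by_cases h : A.Cont n
    · rw [A.st_succ_of_cont h]
      refine ih.trans (max_le_max_left _ ?_)
      linarith [A.Q_nonneg n]
    · refine le_max_of_le_right ?_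
      simp only [A.st_succ_of_not_cont h, AgentState.fresh, pow_succ]
      linarith [A.total_le_sum_Q n, not_le.1 h]

lemma sum_Q_le (n : ℕ) : ∑ t ∈ Finset.range n, A.Q t ≤
    ∑ s ∈ Finset.range n, ((d : ℝ) + Real.exp 1 / 2 * ∑ i, A.p s i / A.q s i) := by
  simp only [A.Q_eq, qTerm]
  exact A.sum_shift_le (g := fun s => (d : ℝ) + Real.exp 1 / 2 * ∑ i, A.p s i / A.q s i)
    (fun s => add_nonneg d.cast_nonneg (mul_nonneg (by positivity) (A.sum_p_div_q_nonneg s))) n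

lemma sum_Q_le_mul_scale (n : ℕ) : ∑ t ∈ Finset.range n, A.Q t ≤ n * scale K d := by
  have hK : (2 : ℝ) ≤ K := by exact_mod_cast A.two_le_card
  have he := Real.add_one_le_exp (1 : ℝ)
  have hKe : 1 ≤ (K : ℝ) * Real.exp 1 := by nlinarith
  calc ∑ t ∈ Finset.range n, A.Q t
      ≤ ∑ s ∈ Finset.range n, ((d : ℝ) + Real.exp 1 / 2 * ∑ i, A.p s i / A.q s i) := A.sum_Q_le n
    _ ≤ ∑ _s ∈ Finset.range n, (K * Real.exp 1 * d + Real.exp 1 * K) := by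
      gcongr with s
      · exact le_mul_of_one_le_left d.cast_nonneg hKe
      · exact A.sum_p_div_q_nonneg s
      · exact half_le_self (Real.exp_pos 1).le
      · exact A.sum_p_div_q_le_card s
    _ = n * scale K d := by
      rw [Finset.sum_const, Finset.card_range, nsmul_eq_mul, scale]
      ring

lemma two_pow_stage_sub_le {n : ℕ} (hn : 1 ≤ n) :
    (2 : ℝ) ^ ((A.st n).stage - firstStage K d) ≤ 2 * n := by
  have hn' : (1 : ℝ) ≤ n := by exact_mod_cast hn
  have hpow : (0 : ℝ) < 2 ^ firstStage K d := by positivity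
  have hscale : scale K d ≤ 2 ^ firstStage K d :=
    (scale_le_log_mul_scale_sq A.two_le_card d).trans (le_two_pow_firstStage A.two_le_card d)
  refine le_of_mul_le_mul_right ?_ hpow
  calc (2 : ℝ) ^ ((A.st n).stage - firstStage K d) * 2 ^ firstStage K d
      = 2 ^ (A.st n).stage := by rw [← pow_add, Nat.sub_add_cancel (A.firstStage_le n)]
    _ ≤ max (2 ^ firstStage K d) (2 * (n * scale K d)) :=
      (A.two_pow_stage_le n).trans (max_le_max_left _ (by linarith [A.sum_Q_le_mul_scale n]))
    _ ≤ 2 * n * 2 ^ firstStage K d := max_le (by nlinarith) (by rw [← mul_assoc]; gcongr)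

lemma stage_sub_le {n : ℕ} (hn : 1 ≤ n) :
    ((A.st n).stage : ℝ) - firstStage K d ≤ 1 + 2 * Real.log n := by
  have hn' : (1 : ℝ) ≤ n := by exact_mod_cast hn
  have hlog := Real.log_nonneg hn'
  have hlog2 := Real.log_two_gt_d9
  have hpow := Real.log_le_log (by positivity) (A.two_pow_stage_sub_le hn)
  rw [Real.log_pow, Real.log_mul two_ne_zero (by positivity),
    Nat.cast_sub (A.firstStage_le n)] at hpow
  by_contra! hcon
  nlinarith

end DoublingTrick

section DelayedRegret

open scoped Classical in
/-- The decrease of the action probabilities caused by the update at the end of round `t`, as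
bounded by `p_sub_p_succ_le` and summed over the actions. -/
noncomputable def drift (t : ℕ) : ℝ :=
  ∑ i, if A.Cont t then A.p t i * (A.eta t * A.est t i + δ) else 0

lemma drift_nonneg (t : ℕ) : 0 ≤ A.drift t := by
  refine Finset.sum_nonneg fun i _ => ?_
  split_ifs
  · exact mul_nonneg (A.p_pos t i).le (add_nonneg (A.eta_mul_est_nonneg t i) A.δ_pos.le)
  · exact le_rfl

open scoped Classical in
lemma drift_le (t : ℕ) :
    A.drift t ≤ (if A.Cont t then ∑ i, A.eta t * A.p t i * A.est t i else 0) + δ := by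
  unfold drift
  split_ifs
  · have hsum : ∑ i, A.p t i * δ = δ := by rw [← Finset.sum_mul, A.sum_p, one_mul]
    simp only [mul_add, Finset.sum_add_distrib, hsum]
    exact add_le_add_left (Finset.sum_congr rfl fun i _ => by ring).le δ
  · simpa using A.δ_pos.le

lemma sum_p_mul_sub_le {t : ℕ} (hc : d < (A.st t).clock) {x : Fin K → ℝ}
    (hx : ∀ i, 0 ≤ x i ∧ x i ≤ 1) :
    ∑ i, A.p (t - d) i * x i - ∑ i, A.p t i * x i ≤ ∑ s ∈ Finset.Ico (t - d) t, A.drift s := by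
  classical
  obtain ⟨s, rfl⟩ := Nat.exists_eq_add_of_le' (A.le_of_lt_clock hc)
  rw [Nat.add_sub_cancel, ← Finset.sum_sub_distrib]
  simp only [drift]
  rw [Finset.sum_comm]
  refine Finset.sum_le_sum fun i _ => ?_
  rw [← sub_mul]
  refine (mul_le_mul_of_nonneg_right (A.p_sub_p_add_le s d (A.cont_of_lt_clock s d hc).1 i)
    (hx i).1).trans (mul_le_of_le_one_right (Finset.sum_nonneg fun u _ => ?_) (hx i).2)
  split_ifs
  · exact mul_nonneg (A.p_pos u i).le (add_nonneg (A.eta_mul_est_nonneg u i) A.δ_pos.le)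
  · exact le_rfl

lemma sum_p_mul_sub_le_one {x : Fin K → ℝ} (hx : ∀ i, 0 ≤ x i ∧ x i ≤ 1) (t : ℕ) (k : Fin K) :
    ∑ i, A.p t i * x i - x k ≤ 1 := by
  calc ∑ i, A.p t i * x i - x k ≤ ∑ i, A.p t i * x i := sub_le_self _ (hx k).1
    _ ≤ ∑ i, A.p t i :=
      Finset.sum_le_sum fun i _ => mul_le_of_le_one_right (A.p_pos t i).le (hx i).2
    _ = 1 := A.sum_p t

open scoped Classical in
lemma sum_le_sum_active_add_card_inactive {x : ℕ → ℝ} (hx : ∀ s, x s ≤ 1) (n : ℕ) :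
    ∑ t ∈ Finset.range n, x t ≤ ∑ t ∈ Finset.range n, (if A.Active t then x (t - d) else 0) +
      ∑ t ∈ Finset.range n, (if A.Active t then (0 : ℝ) else 1) := by
  have hshift := A.sum_shift_le (g := fun s => 1 - x s) (fun s => sub_nonneg.2 (hx s)) n
  have hactive : ∑ t ∈ Finset.range n, (1 - (if A.Active t then (0 : ℝ) else 1) -
      (if A.Active t then x (t - d) else 0)) ≤ ∑ t ∈ Finset.range n, (1 - x t) := by
    refine le_trans (Finset.sum_le_sum fun t _ => ?_) hshift
    have := hx (t - d)
    unfold Active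
    split_ifs <;> simp_all
  simp only [Finset.sum_sub_distrib] at hactive
  linarith

open scoped Classical in
lemma sum_regret_le {ℓ : ℕ → Fin K → ℝ} (hℓ : ∀ t i, 0 ≤ ℓ t i ∧ ℓ t i ≤ 1) {n : ℕ} (hn : 1 ≤ n)
    (k : Fin K) :
    ∑ s ∈ Finset.range n, (∑ i, A.p s i * ℓ s i - ℓ s k) ≤
      ∑ t ∈ Finset.range n,
        (if A.Active t then ∑ i, A.p t i * ℓ (t - d) i - ℓ (t - d) k else 0) +
      d * ∑ t ∈ Finset.range n, A.drift t + (d + 1) * (2 + 2 * Real.log n) := by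
  have hshift : ∑ t ∈ Finset.range n,
        (if A.Active t then ∑ i, A.p (t - d) i * ℓ (t - d) i - ℓ (t - d) k else 0) ≤
      ∑ t ∈ Finset.range n,
        ((if A.Active t then ∑ i, A.p t i * ℓ (t - d) i - ℓ (t - d) k else 0) +
          ∑ s ∈ Finset.Ico (t - d) t, A.drift s) := by
    refine Finset.sum_le_sum fun t _ => ?_
    split_ifs with h
    · linarith [A.sum_p_mul_sub_le h.1 (hℓ (t - d))]
    · exact add_nonneg le_rfl (Finset.sum_nonneg fun s _ => A.drift_nonneg s)
  have hinactive := (A.card_inactive_le n).trans (mul_le_mul_of_nonneg_left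
    (add_le_add_left (A.stage_sub_le hn) 1) (by positivity))
  rw [Finset.sum_add_distrib] at hshift
  linarith [sum_range_sum_Ico_le n d A.drift_nonneg, A.sum_le_sum_active_add_card_inactive
    (fun s => A.sum_p_mul_sub_le_one (hℓ s) s k) n]

open scoped Classical in
lemma sum_variance_add_mul_sum_eta_le (n : ℕ) :
    ∑ t ∈ Finset.range n, (if A.Active t then
      A.eta t * (Real.exp 1 / 2 * ∑ i, A.p (t - d) i / A.q (t - d) i) else 0) +
      d * ∑ t ∈ Finset.range n, (if A.Active t then A.eta t else 0) ≤
    4 * stageScale K (A.st n).stage := by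
  refine le_of_eq_of_le ?_ (A.sum_eta_mul_Q_le n)
  rw [Finset.mul_sum, ← Finset.sum_add_distrib]
  refine Finset.sum_congr rfl fun t _ => ?_
  by_cases hc : A.Cont t <;> by_cases hd : d < (A.st t).clock <;>
    simp only [Active, hc, hd, if_true, if_false, and_true, and_false, mul_zero, add_zero, A.Q_eq,
      qTerm]
  unfold p
  ring

end DelayedRegret

end AgentPath

section Agent

variable {V : Type*} [Fintype V] {K T : ℕ} {G : SimpleGraph V} {d ttl : V → ℕ} {δ : ℝ}
  {ℓ : ℕ → Fin K → ℝ}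

lemma playProb_le_qProb (hδ : 0 < δ) (hK : 0 < K) (a : Fin T → V → Fin K) (t : ℕ) (v : V)
    (i : Fin K) : playProb G d ttl δ ℓ a t v i ≤ qProb G d ttl δ ℓ a t v i :=
  le_hitProb (fun u => (playProb_pos hδ hK a t u i).le) (fun _ => actionProb_le_one hδ hK _ i)
    (mem_inNbhd_self G d ttl v)

lemma qProb_pos (hδ : 0 < δ) (hK : 0 < K) (a : Fin T → V → Fin K) (t : ℕ) (v : V)
    (i : Fin K) : 0 < qProb G d ttl δ ℓ a t v i :=
  (playProb_pos hδ hK a t v i).trans_le (playProb_le_qProb hδ hK a t v i)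

/-- The evolution of agent `v` when the actions `a` are played. -/
noncomputable def agentPath (hδ : 0 < δ) (hK : 2 ≤ K) (hℓ : ∀ t i, 0 ≤ ℓ t i ∧ ℓ t i ≤ 1)
    (G : SimpleGraph V) (d ttl : V → ℕ) (a : Fin T → V → Fin K) (v : V) : AgentPath K δ (d v) where
  st t := run G d ttl δ ℓ a t v
  est t := estAt G d ttl δ ℓ a t v
  q s := qProb G d ttl δ ℓ a s v
  Q t := qAt G d ttl δ ℓ a t v
  δ_pos := hδ
  two_le_card := hK
  st_zero := run_zero G d ttl δ ℓ a v
  st_succ t := run_succ G d ttl δ ℓ a t v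
  Q_eq _ := rfl
  est_eq_zero _ h _ := if_neg (not_lt.2 h)
  est_nonneg t i := by
    have hq : 0 < qProb G d ttl δ ℓ a (t - d v) v i := qProb_pos hδ (by omega) a _ v i
    have hℓ0 := (hℓ (t - d v) i).1
    unfold estAt lossEst
    split_ifs <;> first | exact le_rfl | positivity
  est_le t i := by
    have hq : 0 < qProb G d ttl δ ℓ a (t - d v) v i := qProb_pos hδ (by omega) a _ v i
    have hdiv := div_le_div_of_nonneg_right (hℓ (t - d v) i).2 hq.le
    unfold estAt lossEst
    split_ifs
    · rwa [mul_one]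
    · rw [mul_zero]; positivity
    · positivity
  prob_le t i := playProb_le_qProb hδ (by omega) a t v i

variable (hδ : 0 < δ) (hK : 2 ≤ K) (hℓ : ∀ t i, 0 ≤ ℓ t i ∧ ℓ t i ≤ 1)

open scoped Classical in
/-- The state in round `t` and the probabilities `q` of round `t - d v` are determined by the
actions before round `t - d v`, so averaging over the actions of that round replaces the event in
the estimate by its conditional probability `q`. -/
lemma expect_sum_mul_est {t : ℕ} (ht : t < T) (v : V) (F : Fin K → AgentState K → ℝ) {φ : ℝ → ℝ}
    (hφ : φ 0 = 0) :
    expect G d ttl δ ℓ (fun a : Fin T → V → Fin K =>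
      let A := agentPath hδ hK hℓ G d ttl a v
      if A.Cont t then ∑ i, F i (A.st t) * φ (A.est t i) else 0) =
    expect G d ttl δ ℓ (fun a : Fin T → V → Fin K =>
      let A := agentPath hδ hK hℓ G d ttl a v
      if A.Active t then ∑ i, F i (A.st t) *
        (φ (ℓ (t - d v) i / A.q (t - d v) i) * A.q (t - d v) i) else 0) := by
  set A := fun a : Fin T → V → Fin K => agentPath hδ hK hℓ G d ttl a v
  set X : Fin K → (Fin T → V → Fin K) → ℝ := fun i a => if (A a).Active t then
    F i ((A a).st t) * φ (ℓ (t - d v) i / (A a).q (t - d v) i) else 0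
  have hX : ∀ i, DependsOn (X i) {τ : Fin T | (τ : ℕ) < t - d v} := fun i a a' h => by
    have hst : (A a).st t = (A a').st t := dependsOn_run_sub G d ttl δ ℓ t v h
    have hQ : (A a).Q t = (A a').Q t := dependsOn_qAt G d ttl δ ℓ t v h
    have hq : (A a).q (t - d v) = (A a').q (t - d v) := dependsOn_qProb G d ttl δ ℓ (t - d v) v h
    have hactive : (A a).Active t ↔ (A a').Active t := by
      simp only [AgentPath.Active, AgentPath.Cont, hst, hQ]
    simp only [X, hactive, hst, hq]
  have hest : ∀ a, (if (A a).Cont t then ∑ i, F i ((A a).st t) * φ ((A a).est t i) else 0) =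
      ∑ i, X i a * if Hit G d ttl a (t - d v) v i then 1 else 0 := fun a => by
    by_cases hc : (A a).Cont t <;> by_cases hd : d v < ((A a).st t).clock
    · have hi : ∀ i, (A a).est t i = ℓ (t - d v) i / (A a).q (t - d v) i *
          if Hit G d ttl a (t - d v) v i then 1 else 0 := fun i => if_pos hd
      simp only [X, AgentPath.Active, hc, hd, and_self, if_true, hi]
      refine Finset.sum_congr rfl fun i _ => ?_
      split_ifs <;> simp [hφ]
    · simp [X, AgentPath.Active, hc, hd, (A a).est_eq_zero t (not_lt.1 hd), hφ]
    all_goals simp [X, AgentPath.Active, hc]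
  calc expect G d ttl δ ℓ _ = expect G d ttl δ ℓ fun a =>
          ∑ i, X i a * if Hit G d ttl a (t - d v) v i then 1 else 0 := congrArg _ (funext hest)
    _ = expect G d ttl δ ℓ fun a => ∑ i, X i a * (A a).q (t - d v) i := by
        rw [expect_sum, expect_sum]
        exact Finset.sum_congr rfl fun i _ => expect_hit hδ (by omega) (by omega) v i (hX i)
    _ = _ := by
        congr 1
        funext a
        by_cases hc : (A a).Active t <;> simp [X, A, hc, mul_assoc]

open scoped Classical in
lemma expect_sum_regret_est {t : ℕ} (ht : t < T) (v : V) (k : Fin K) :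
    expect G d ttl δ ℓ (fun a : Fin T → V → Fin K =>
      let A := agentPath hδ hK hℓ G d ttl a v
      if A.Cont t then ∑ i, A.p t i * A.est t i - A.est t k else 0) =
    expect G d ttl δ ℓ (fun a : Fin T → V → Fin K =>
      let A := agentPath hδ hK hℓ G d ttl a v
      if A.Active t then ∑ i, A.p t i * ℓ (t - d v) i - ℓ (t - d v) k else 0) := by
  have hsum : ∀ (p x : Fin K → ℝ),
      ∑ i, (p i - if i = k then 1 else 0) * x i = ∑ i, p i * x i - x k := fun p x => by
    simp [sub_mul, Finset.sum_sub_distrib]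
  have hq : ∀ (a : Fin T → V → Fin K) i, ℓ (t - d v) i / (agentPath hδ hK hℓ G d ttl a v).q
      (t - d v) i * (agentPath hδ hK hℓ G d ttl a v).q (t - d v) i = ℓ (t - d v) i := fun a i =>
    div_mul_cancel₀ _ ((agentPath hδ hK hℓ G d ttl a v).q_pos _ i).ne'
  have h := expect_sum_mul_est (G := G) (d := d) (ttl := ttl) hδ hK hℓ ht v
    (fun i s => actionProb δ s.weight i - if i = k then 1 else 0) (φ := fun x => x) rfl
  simp only [hsum, hq] at h
  exact h

lemma expect_drift_le {t : ℕ} (ht : t < T) (v : V) :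
    expect G d ttl δ ℓ (fun a : Fin T → V → Fin K =>
      (agentPath hδ hK hℓ G d ttl a v).drift t) ≤
    expect G d ttl δ ℓ (fun a : Fin T → V → Fin K =>
      let A := agentPath hδ hK hℓ G d ttl a v
      open scoped Classical in if A.Active t then A.eta t else 0) + δ := by
  classical
  have hK0 : 0 < K := by omega
  have h := expect_sum_mul_est (G := G) (d := d) (ttl := ttl) hδ hK hℓ ht v
    (fun i s => etaStage K (d v) s.stage * actionProb δ s.weight i) (φ := fun x => x) rfl
  have hmono := expect_mono (G := G) (d := d) (ttl := ttl) (ℓ := ℓ) hδ hK0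
    fun a : Fin T → V → Fin K => (agentPath hδ hK hℓ G d ttl a v).drift_le t
  rw [expect_add, expect_const hδ hK0] at hmono
  refine hmono.trans (add_le_add_left (h.le.trans (expect_mono hδ hK0 fun a => ?_)) δ)
  set A := agentPath hδ hK hℓ G d ttl a v
  dsimp only
  split_ifs
  · calc ∑ i, A.eta t * A.p t i * (ℓ (t - d v) i / A.q (t - d v) i * A.q (t - d v) i)
        ≤ ∑ i, A.eta t * A.p t i := Finset.sum_le_sum fun i _ => by
          rw [div_mul_cancel₀ _ (A.q_pos _ i).ne']
          exact mul_le_of_le_one_right (mul_pos (A.eta_pos t) (A.p_pos t i)).le (hℓ _ i).2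
      _ = A.eta t := by rw [← Finset.mul_sum, A.sum_p, mul_one]
  · exact le_rfl

open scoped Classical in
lemma expect_variance_le (hT : δ * T ≤ 1) {t : ℕ} (ht : t < T) (v : V) :
    expect G d ttl δ ℓ (fun a : Fin T → V → Fin K =>
      let A := agentPath hδ hK hℓ G d ttl a v
      if A.Cont t then A.eta t / 2 * ∑ i, A.p t i * A.est t i ^ 2 else 0) ≤
    expect G d ttl δ ℓ (fun a : Fin T → V → Fin K =>
      let A := agentPath hδ hK hℓ G d ttl a v
      if A.Active t then
        A.eta t * (Real.exp 1 / 2 * ∑ i, A.p (t - d v) i / A.q (t - d v) i) else 0) := by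
  have h := expect_sum_mul_est (G := G) (d := d) (ttl := ttl) hδ hK hℓ ht v
    (fun i s => etaStage K (d v) s.stage / 2 * actionProb δ s.weight i) (φ := fun x => x ^ 2)
    (zero_pow two_ne_zero)
  simp only [Finset.mul_sum, ← mul_assoc]
  refine h.le.trans (expect_mono hδ (by omega) fun a => ?_)
  set A := agentPath hδ hK hℓ G d ttl a v
  dsimp only
  split_ifs with hA
  · have hdT : δ * d v ≤ 1 := by
      have hdt : d v ≤ T := (A.le_of_lt_clock hA.1).trans ht.le
      exact (mul_le_mul_of_nonneg_left (by exact_mod_cast hdt) hδ.le).trans hT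
    refine Finset.sum_le_sum fun i _ => ?_
    have hη := A.eta_pos t
    have hp := A.p_pos (t - d v) i
    have hq := A.q_pos (t - d v) i
    have hℓ_sq : ℓ (t - d v) i ^ 2 ≤ 1 := pow_le_one₀ (hℓ _ i).1 (hℓ _ i).2
    calc A.eta t / 2 * A.p t i * ((ℓ (t - d v) i / A.q (t - d v) i) ^ 2 * A.q (t - d v) i)
        = A.eta t / 2 * A.p t i * (ℓ (t - d v) i ^ 2 / A.q (t - d v) i) := by field_simp
      _ ≤ A.eta t / 2 * (Real.exp 1 * A.p (t - d v) i) * (1 / A.q (t - d v) i) := by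
        gcongr
        exact A.p_le_exp_mul hdT hA.1 i
      _ = _ := by ring
  · exact le_rfl

lemma expect_sum_loss_sub_eq (v : V) (k : Fin K) :
    expect G d ttl δ ℓ (fun a : Fin T → V → Fin K => ∑ t : Fin T, ℓ t (a t v)) -
        ∑ t : Fin T, ℓ t k =
      expect G d ttl δ ℓ (fun a : Fin T → V → Fin K => ∑ s ∈ Finset.range T,
        (∑ i, (agentPath hδ hK hℓ G d ttl a v).p s i * ℓ s i - ℓ s k)) := by
  have hK0 : 0 < K := by omega
  simp only [Finset.sum_range]
  rw [expect_sum, expect_sum, ← Finset.sum_sub_distrib]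
  refine Finset.sum_congr rfl fun t _ => ?_
  rw [expect_play hδ hK0 t v (ℓ t), expect_sub, expect_const hδ hK0]
  rfl

open scoped Classical in
lemma expect_sum_regret_le (hT : 1 ≤ T) (v : V) (k : Fin K) :
    expect G d ttl δ ℓ (fun a : Fin T → V → Fin K => ∑ s ∈ Finset.range T,
        (∑ i, (agentPath hδ hK hℓ G d ttl a v).p s i * ℓ s i - ℓ s k)) ≤
      ∑ t ∈ Finset.range T, expect G d ttl δ ℓ (fun a : Fin T → V → Fin K =>
        let A := agentPath hδ hK hℓ G d ttl a v
        if A.Active t then ∑ i, A.p t i * ℓ (t - d v) i - ℓ (t - d v) k else 0) +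
      d v * ∑ t ∈ Finset.range T, expect G d ttl δ ℓ (fun a : Fin T → V → Fin K =>
        (agentPath hδ hK hℓ G d ttl a v).drift t) +
      (d v + 1) * (2 + 2 * Real.log T) := by
  have hK0 : 0 < K := by omega
  have h := expect_mono (G := G) (d := d) (ttl := ttl) (ℓ := ℓ) hδ hK0
    fun a : Fin T → V → Fin K => (agentPath hδ hK hℓ G d ttl a v).sum_regret_le hℓ hT k
  rw [expect_add, expect_add, expect_const_mul, expect_const hδ hK0] at h
  simpa only [expect_sum] using h

open scoped Classical in
lemma sum_expect_active_regret_le (hδT : δ * T ≤ 1) (hδ1 : δ ≤ 1) (v : V) (k : Fin K) :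
    ∑ t ∈ Finset.range T, expect G d ttl δ ℓ (fun a : Fin T → V → Fin K =>
        let A := agentPath hδ hK hℓ G d ttl a v
        if A.Active t then ∑ i, A.p t i * ℓ (t - d v) i - ℓ (t - d v) k else 0) ≤
      6 * expect G d ttl δ ℓ (fun a : Fin T → V → Fin K =>
        stageScale K (run G d ttl δ ℓ a T v).stage) +
      ∑ t ∈ Finset.range T, expect G d ttl δ ℓ (fun a : Fin T → V → Fin K =>
        let A := agentPath hδ hK hℓ G d ttl a v
        if A.Active t then
          A.eta t * (Real.exp 1 / 2 * ∑ i, A.p (t - d v) i / A.q (t - d v) i) else 0) := by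
  have h := expect_mono (G := G) (d := d) (ttl := ttl) (ℓ := ℓ) hδ (by omega)
    fun a : Fin T → V → Fin K => (agentPath hδ hK hℓ G d ttl a v).sum_cont_le hδ1 T hδT k
  rw [expect_add, expect_const_mul, expect_sum, expect_sum] at h
  rw [← Finset.sum_congr rfl fun t ht =>
    expect_sum_regret_est hδ hK hℓ (Finset.mem_range.1 ht) v k]
  exact h.trans (add_le_add_right (Finset.sum_le_sum fun t ht =>
    expect_variance_le hδ hK hℓ hδT (Finset.mem_range.1 ht) v) _)

open scoped Classical in
lemma sum_expect_drift_le (hδT : δ * T ≤ 1) (v : V) :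
    ∑ t ∈ Finset.range T, expect G d ttl δ ℓ (fun a : Fin T → V → Fin K =>
        (agentPath hδ hK hℓ G d ttl a v).drift t) ≤
      ∑ t ∈ Finset.range T, expect G d ttl δ ℓ (fun a : Fin T → V → Fin K =>
        let A := agentPath hδ hK hℓ G d ttl a v
        if A.Active t then A.eta t else 0) + 1 := by
  refine (Finset.sum_le_sum fun t ht =>
    expect_drift_le hδ hK hℓ (Finset.mem_range.1 ht) v).trans ?_
  rw [Finset.sum_add_distrib, Finset.sum_const, Finset.card_range, nsmul_eq_mul, mul_comm (T : ℝ)]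
  exact add_le_add_right hδT _

open scoped Classical in
lemma sum_expect_variance_add_le (v : V) :
    ∑ t ∈ Finset.range T, expect G d ttl δ ℓ (fun a : Fin T → V → Fin K =>
        let A := agentPath hδ hK hℓ G d ttl a v
        if A.Active t then
          A.eta t * (Real.exp 1 / 2 * ∑ i, A.p (t - d v) i / A.q (t - d v) i) else 0) +
      d v * ∑ t ∈ Finset.range T, expect G d ttl δ ℓ (fun a : Fin T → V → Fin K =>
        let A := agentPath hδ hK hℓ G d ttl a v
        if A.Active t then A.eta t else 0) ≤
    4 * expect G d ttl δ ℓ (fun a : Fin T → V → Fin K =>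
      stageScale K (run G d ttl δ ℓ a T v).stage) := by
  have h := expect_mono (G := G) (d := d) (ttl := ttl) (ℓ := ℓ) hδ (by omega)
    fun a : Fin T → V → Fin K =>
      (agentPath hδ hK hℓ G d ttl a v).sum_variance_add_mul_sum_eta_le T
  rw [expect_add, expect_const_mul, expect_const_mul, expect_sum, expect_sum] at h
  exact h

include hδ hK hℓ

lemma expect_regret_agent_le (hT : 1 ≤ T) (hδT : δ * T ≤ 1) (v : V) (k : Fin K) :
    expect G d ttl δ ℓ (fun a : Fin T → V → Fin K => ∑ t : Fin T, ℓ t (a t v)) -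
        ∑ t : Fin T, ℓ t k ≤
      10 * expect G d ttl δ ℓ (fun a : Fin T → V → Fin K =>
        stageScale K (run G d ttl δ ℓ a T v).stage) + d v + (d v + 1) * (2 + 2 * Real.log T) := by
  have hδ1 : δ ≤ 1 := (le_mul_of_one_le_right hδ.le (by exact_mod_cast hT)).trans hδT
  have hdrift := mul_le_mul_of_nonneg_left (sum_expect_drift_le (G := G) (d := d) (ttl := ttl)
    hδ hK hℓ hδT v) (d v).cast_nonneg
  rw [expect_sum_loss_sub_eq hδ hK hℓ]
  linarith [expect_sum_regret_le (G := G) (d := d) (ttl := ttl) hδ hK hℓ hT v k,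
    sum_expect_active_regret_le (G := G) (d := d) (ttl := ttl) hδ hK hℓ hδT hδ1 v k,
    sum_expect_variance_add_le (T := T) (G := G) (d := d) (ttl := ttl) hδ hK hℓ v]

lemma two_pow_stage_agent_le (a : Fin T → V → Fin K) (v : V) :
    (2 : ℝ) ^ (run G d ttl δ ℓ a T v).stage ≤ 2 ^ firstStage K (d v) +
      ∑ s ∈ Finset.range T, (2 * (d v : ℝ) + Real.exp 1 *
        ∑ i, playProb G d ttl δ ℓ a s v i / qProb G d ttl δ ℓ a s v i) := by
  set A := agentPath hδ hK hℓ G d ttl a v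
  have hQ : 0 ≤ ∑ t ∈ Finset.range T, A.Q t := Finset.sum_nonneg fun t _ => A.Q_nonneg t
  have hpow : (0 : ℝ) < 2 ^ firstStage K (d v) := by positivity
  calc (2 : ℝ) ^ (A.st T).stage ≤ max (2 ^ firstStage K (d v)) (2 * ∑ t ∈ Finset.range T, A.Q t) :=
        A.two_pow_stage_le T
    _ ≤ 2 ^ firstStage K (d v) + 2 * ∑ t ∈ Finset.range T, A.Q t :=
        max_le_add_of_nonneg hpow.le (by positivity)
    _ ≤ 2 ^ firstStage K (d v) + 2 * ∑ s ∈ Finset.range T,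
          ((d v : ℝ) + Real.exp 1 / 2 * ∑ i, A.p s i / A.q s i) := by linarith [A.sum_Q_le T]
    _ = 2 ^ firstStage K (d v) + ∑ s ∈ Finset.range T,
          (2 * (d v : ℝ) + Real.exp 1 * ∑ i, A.p s i / A.q s i) := by
        rw [Finset.mul_sum]
        exact congrArg _ (Finset.sum_congr rfl fun s _ => by ring)

end Agent

section Welfare

lemma log_mul_two_pow_firstStage_le {K : ℕ} (hK : 2 ≤ K) (n : ℕ) {S : ℝ} (hKS : (K : ℝ) ≤ S)
    (hnS : (n : ℝ) + 1 ≤ S) : Real.log K * 2 ^ firstStage K n ≤ 18 * S ^ 6 := by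
  have hK0 : (0 : ℝ) < K := by exact_mod_cast (by omega : 0 < K)
  have hS : 0 ≤ S := hK0.le.trans hKS
  have : 0 ≤ Real.log K := Real.log_natCast_nonneg K
  have hlog : Real.log K ≤ S :=
    ((Real.log_le_sub_one_of_pos hK0).trans (sub_le_self _ one_pos.le)).trans hKS
  have hscale : scale K n ≤ S * 3 * S := by
    unfold scale
    have he : Real.exp 1 ≤ 3 := Real.exp_one_lt_three.le
    gcongr
  have hscale0 := scale_pos hK n
  calc Real.log K * 2 ^ firstStage K n ≤ Real.log K * (2 * (Real.log K * scale K n ^ 2)) := by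
        gcongr
        exact two_pow_firstStage_le hK n
    _ ≤ S * (2 * (S * (S * 3 * S) ^ 2)) := by gcongr
    _ = 18 * S ^ 6 := by ring

lemma stageScale_le {K : ℕ} (hK : 2 ≤ K) (r : ℕ) {B : ℝ} (hB : 0 < B) :
    stageScale K r ≤ (Real.log K * 2 ^ r / B + B) / 2 := by
  rw [← stageScale_sq hK r, div_add' _ _ _ hB.ne', div_div, le_div_iff₀ (by positivity)]
  linarith [two_mul_le_add_sq (stageScale K r) B]

variable {V : Type*} [Fintype V]

/-- The term `√(ln K (d̄_V + 1 + (K / N) α(G_P) ln (T N K)) T)` of the regret bound, where `N` is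
the number of agents. -/
noncomputable def regretScale (G : SimpleGraph V) (d ttl : V → ℕ) (K T : ℕ) : ℝ :=
  √(Real.log K * (meanDelay d + 1 + (K : ℝ) / Fintype.card V * alphaP G d ttl *
    Real.log ((T : ℝ) * Fintype.card V * K)) * T)

lemma meanDelay_nonneg (d : V → ℕ) : 0 ≤ meanDelay d := by
  unfold meanDelay
  positivity

variable [Nonempty V]

lemma card_mul_meanDelay (d : V → ℕ) : Fintype.card V * meanDelay d = ∑ v, (d v : ℝ) := by
  have hN : (Fintype.card V : ℝ) ≠ 0 := Nat.cast_ne_zero.2 Fintype.card_ne_zero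
  rw [meanDelay, ← mul_assoc, mul_one_div_cancel hN, one_mul]

lemma meanDelay_le_sum (d : V → ℕ) : meanDelay d ≤ ∑ v, (d v : ℝ) := by
  rw [← card_mul_meanDelay]
  exact le_mul_of_one_le_left (meanDelay_nonneg d) (by exact_mod_cast Fintype.card_pos)

variable {K T : ℕ} (hK : 2 ≤ K) (hT : 1 ≤ T)

section
include hK hT

lemma half_le_log_horizon (V : Type*) [Fintype V] [Nonempty V] :
    1 / 2 ≤ Real.log ((T : ℝ) * Fintype.card V * K) := by
  have h : 2 ≤ T * Fintype.card V * K :=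
    hK.trans (Nat.le_mul_of_pos_left K (Nat.mul_pos hT Fintype.card_pos))
  exact_mod_cast half_le_log h

lemma neg_log_two_le_log_log_horizon (V : Type*) [Fintype V] [Nonempty V] :
    -Real.log 2 ≤ Real.log (Real.log ((T : ℝ) * Fintype.card V * K)) := by
  rw [← Real.log_inv, ← one_div]
  exact Real.log_le_log one_half_pos (half_le_log_horizon hK hT V)

lemma one_add_log_div_le (V : Type*) [Fintype V] [Nonempty V] :
    1 + Real.log (Fintype.card V / (1 / (T : ℝ) / (2 * K))) ≤
      5 * Real.log ((T : ℝ) * Fintype.card V * K) := by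
  have : (0 : ℝ) < T := by exact_mod_cast hT
  have : (0 : ℝ) < K := by exact_mod_cast (by omega : 0 < K)
  have : (0 : ℝ) < Fintype.card V := by exact_mod_cast Fintype.card_pos
  have heq : (Fintype.card V : ℝ) / (1 / (T : ℝ) / (2 * K)) = 2 * (T * Fintype.card V * K) := by
    field_simp
  rw [heq, Real.log_mul two_ne_zero (by positivity)]
  linarith [Real.log_two_lt_d9, half_le_log_horizon hK hT V]

variable (G : SimpleGraph V) (d ttl : V → ℕ)

lemma card_mul_regretScale_sq : Fintype.card V * regretScale G d ttl K T ^ 2 =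
    Real.log K * (T * (∑ v, (d v : ℝ) + Fintype.card V +
      K * alphaP G d ttl * Real.log ((T : ℝ) * Fintype.card V * K))) := by
  have hN0 : (Fintype.card V : ℝ) ≠ 0 := by exact_mod_cast Fintype.card_ne_zero
  have hL : 0 ≤ Real.log ((T : ℝ) * Fintype.card V * K) :=
    one_half_pos.le.trans (half_le_log_horizon hK hT V)
  have hmean := meanDelay_nonneg d
  have := Real.log_natCast_nonneg K
  rw [regretScale, Real.sq_sqrt (by positivity), ← card_mul_meanDelay]
  field_simp

lemma sqrt_le_two_mul_regretScale : √(T : ℝ) ≤ 2 * regretScale G d ttl K T := by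
  have hL : 0 ≤ Real.log ((T : ℝ) * Fintype.card V * K) :=
    one_half_pos.le.trans (half_le_log_horizon hK hT V)
  have hα : 0 ≤ (K : ℝ) / Fintype.card V * alphaP G d ttl *
    Real.log ((T : ℝ) * Fintype.card V * K) := by positivity
  have hlog := half_le_log hK
  have hmean := meanDelay_nonneg d
  have hrate : 1 / 2 * 1 ≤ Real.log K * (meanDelay d + 1 + (K : ℝ) / Fintype.card V *
      alphaP G d ttl * Real.log ((T : ℝ) * Fintype.card V * K)) := by
    gcongr
    linarith
  have hT0 : (0 : ℝ) ≤ T := T.cast_nonneg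
  rw [regretScale, ← Real.sqrt_sq zero_le_two, ← Real.sqrt_mul (by positivity)]
  refine Real.sqrt_le_sqrt ?_
  linarith [mul_le_mul_of_nonneg_right hrate hT0]

lemma half_le_regretScale : 1 / 2 ≤ regretScale G d ttl K T := by
  have h := Real.one_le_sqrt.2 (show (1 : ℝ) ≤ T by exact_mod_cast hT)
  linarith [sqrt_le_two_mul_regretScale hK hT G d ttl]

lemma log_le_four_mul_regretScale : Real.log T ≤ 4 * regretScale G d ttl K T := by
  have hT0 : (0 : ℝ) < T := by exact_mod_cast hT
  have h := Real.log_le_self (Real.sqrt_nonneg (T : ℝ))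
  rw [Real.log_sqrt hT0.le] at h
  linarith [sqrt_le_two_mul_regretScale hK hT G d ttl]

end

variable {G : SimpleGraph V} {d ttl : V → ℕ} {ℓ : ℕ → Fin K → ℝ}
  (hℓ : ∀ t i, 0 ≤ ℓ t i ∧ ℓ t i ≤ 1)
include hK hT hℓ

lemma sum_sum_playProb_div_qProb_le (a : Fin T → V → Fin K) (s : ℕ) :
    ∑ v, ∑ i, playProb G d ttl (1 / T) ℓ a s v i / qProb G d ttl (1 / T) ℓ a s v i ≤
      2 * Fintype.card V +
        20 * (K * alphaP G d ttl * Real.log ((T : ℝ) * Fintype.card V * K)) := by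
  have hT1 : (1 : ℝ) ≤ T := by exact_mod_cast hT
  have hδ : (0 : ℝ) < 1 / T := by positivity
  set p := playProb G d ttl (1 / T) ℓ a s
  set L := Real.log ((T : ℝ) * Fintype.card V * K)
  have hp : ∀ v i, 1 / (T : ℝ) / (2 * K) ≤ p v i := fun v i =>
    le_actionProb hδ ((div_le_one (by linarith)).2 hT1) (by omega)
      (fun j => ((agentPath hδ hK hℓ G d ttl a v).weight_pos s j).le) i
  have hp1 : ∀ v i, p v i ≤ 1 := fun v i => actionProb_le_one hδ (by omega) _ i
  have hsum : ∀ v, ∑ i, p v i = 1 := fun v => sum_playProb hδ (by omega) a s v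
  calc ∑ v, ∑ i, p v i / qProb G d ttl (1 / T) ℓ a s v i
      = ∑ i, ∑ v, p v i / hitProb (inNbhd G d ttl v) p i := Finset.sum_comm
    _ ≤ ∑ i, (2 * ∑ v, p v i + 4 * alphaP G d ttl * (5 * L)) := by
        refine Finset.sum_le_sum fun i _ => (sum_div_hitProb_le G d ttl (by positivity)
          (fun v => hp v i) fun v => hp1 v i).trans ?_
        gcongr
        exact one_add_log_div_le hK hT V
    _ = 2 * Fintype.card V + 20 * (K * alphaP G d ttl * L) := by
        rw [Finset.sum_add_distrib, ← Finset.mul_sum, Finset.sum_comm]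
        simp only [hsum, Finset.sum_const, Finset.card_univ, Fintype.card_fin, nsmul_eq_mul]
        ring

lemma sum_two_pow_stage_le (a : Fin T → V → Fin K) :
    ∑ v, (2 : ℝ) ^ (run G d ttl (1 / T) ℓ a T v).stage ≤ ∑ v, (2 : ℝ) ^ firstStage K (d v) +
      60 * (T * (∑ v, (d v : ℝ) + Fintype.card V +
        K * alphaP G d ttl * Real.log ((T : ℝ) * Fintype.card V * K))) := by
  have hδ : (0 : ℝ) < 1 / T := by positivity
  set p := playProb G d ttl (1 / (T : ℝ)) ℓ a
  set q := qProb G d ttl (1 / (T : ℝ)) ℓ a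
  set L := Real.log ((T : ℝ) * Fintype.card V * K)
  have hL : 0 ≤ L := one_half_pos.le.trans (half_le_log_horizon hK hT V)
  have hround : ∀ s, 2 * ∑ v, (d v : ℝ) + Real.exp 1 * ∑ v, ∑ i, p s v i / q s v i ≤
      60 * (∑ v, (d v : ℝ) + Fintype.card V + K * alphaP G d ttl * L) := fun s => by
    have hd : 0 ≤ ∑ v, (d v : ℝ) := by positivity
    have : 0 ≤ K * alphaP G d ttl * L := by positivity
    have hpq : Real.exp 1 * ∑ v, ∑ i, p s v i / q s v i ≤
        3 * (2 * Fintype.card V + 20 * (K * alphaP G d ttl * L)) :=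
      (mul_le_mul_of_nonneg_left (sum_sum_playProb_div_qProb_le hK hT hℓ a s)
        (Real.exp_pos 1).le).trans
          (mul_le_mul_of_nonneg_right Real.exp_one_lt_three.le (by positivity))
    linarith
  calc ∑ v, (2 : ℝ) ^ (run G d ttl (1 / T) ℓ a T v).stage
      ≤ ∑ v, ((2 : ℝ) ^ firstStage K (d v) + ∑ s ∈ Finset.range T,
          (2 * (d v : ℝ) + Real.exp 1 * ∑ i, p s v i / q s v i)) :=
        Finset.sum_le_sum fun v _ => two_pow_stage_agent_le hδ hK hℓ a v
    _ = ∑ v, (2 : ℝ) ^ firstStage K (d v) + ∑ s ∈ Finset.range T, (2 * ∑ v, (d v : ℝ) +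
          Real.exp 1 * ∑ v, ∑ i, p s v i / q s v i) := by
        rw [Finset.sum_add_distrib, Finset.sum_comm]
        simp only [Finset.sum_add_distrib, Finset.mul_sum]
    _ ≤ _ := by
        refine add_le_add_right ((Finset.sum_le_card_nsmul _ _ _ fun s _ => hround s).trans_eq ?_) _
        rw [Finset.card_range, nsmul_eq_mul]
        ring

lemma sum_stageScale_stage_le {S : ℝ} (hKS : (K : ℝ) ≤ S) (hdS : ∀ v, (d v : ℝ) + 1 ≤ S)
    (a : Fin T → V → Fin K) :
    ∑ v, stageScale K (run G d ttl (1 / T) ℓ a T v).stage ≤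
      Fintype.card V * (18 * S ^ 6 + 30.5 * regretScale G d ttl K T) := by
  set B := regretScale G d ttl K T
  set r := fun v => (run G d ttl (1 / T) ℓ a T v).stage
  have hB : 1 / 2 ≤ B := half_le_regretScale hK hT G d ttl
  have : 0 ≤ S := K.cast_nonneg.trans hKS
  have hfirst : ∑ v, Real.log K * 2 ^ firstStage K (d v) ≤ Fintype.card V * (18 * S ^ 6) := by
    simpa using Finset.sum_le_sum fun v (_ : v ∈ Finset.univ) =>
      log_mul_two_pow_firstStage_le hK (d v) hKS (hdS v)
  have hlast : Real.log K * ∑ v, (2 : ℝ) ^ r v ≤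
      Fintype.card V * (18 * S ^ 6 + 60 * B ^ 2) := by
    have h := mul_le_mul_of_nonneg_left
      (sum_two_pow_stage_le (G := G) (d := d) (ttl := ttl) hK hT hℓ a) (Real.log_natCast_nonneg K)
    rw [← Finset.mul_sum] at hfirst
    linarith [card_mul_regretScale_sq hK hT G d ttl]
  calc ∑ v, stageScale K (r v) ≤ ∑ v, (Real.log K * 2 ^ r v / B + B) / 2 :=
        Finset.sum_le_sum fun v _ => stageScale_le hK (r v) (by linarith)
    _ = (Real.log K * ∑ v, (2 : ℝ) ^ r v) / (2 * B) + Fintype.card V * (B / 2) := by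
        rw [← Finset.sum_div, Finset.sum_add_distrib, ← Finset.sum_div, Finset.mul_sum,
          Finset.sum_const, Finset.card_univ, nsmul_eq_mul]
        field_simp
    _ ≤ Fintype.card V * (18 * S ^ 6 + 60 * B ^ 2) / (2 * B) + Fintype.card V * (B / 2) := by
        gcongr
    _ = Fintype.card V * (18 * S ^ 6 / (2 * B) + 30.5 * B) := by field_simp; ring
    _ ≤ _ := by
        gcongr
        exact div_le_self (by positivity) (by linarith)

lemma welfareRegret_le {S : ℝ} (hKS : (K : ℝ) ≤ S) (hdS : ∀ v, (d v : ℝ) + 1 ≤ S) :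
    welfareRegret G d ttl (1 / (T : ℝ)) ℓ T ≤ 180 * S ^ 6 + 305 * regretScale G d ttl K T +
      meanDelay d + (meanDelay d + 1) * (2 + 2 * Real.log T) := by
  have hN : (0 : ℝ) < Fintype.card V := by exact_mod_cast Fintype.card_pos
  have hT0 : (0 : ℝ) < T := by exact_mod_cast hT
  have hδ : (0 : ℝ) < 1 / T := by positivity
  have : Nonempty (Fin K) := ⟨⟨0, by omega⟩⟩
  obtain ⟨k, hk⟩ := exists_eq_ciInf_of_finite (f := fun i : Fin K => ∑ t : Fin T, ℓ t i)
  have hstage : ∑ v, expect G d ttl (1 / T) ℓ (fun a : Fin T → V → Fin K =>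
      stageScale K (run G d ttl (1 / T) ℓ a T v).stage) ≤
      Fintype.card V * (18 * S ^ 6 + 30.5 * regretScale G d ttl K T) := by
    rw [← expect_sum]
    exact (expect_mono hδ (by omega) (sum_stageScale_stage_le hK hT hℓ hKS hdS)).trans_eq
      (expect_const hδ (by omega) _)
  have hagents := Finset.sum_le_sum fun v (_ : v ∈ Finset.univ) =>
    expect_regret_agent_le (G := G) (d := d) (ttl := ttl) hδ hK hℓ hT
      (one_div_mul_cancel hT0.ne').le v k
  simp only [Finset.sum_sub_distrib, Finset.sum_add_distrib, ← Finset.mul_sum, ← Finset.sum_mul,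
    Finset.sum_const, Finset.card_univ, nsmul_eq_mul, mul_one, ← card_mul_meanDelay] at hagents
  rw [welfareRegret, ← hk, sub_le_iff_le_add, one_div, inv_mul_le_iff₀ hN]
  linarith

end Welfare

end ExpCoop

theorem corollaryc_general {V : Type*} [Fintype V] [Nonempty V] {K T : ℕ} (G : SimpleGraph V)
    (d ttl : V → ℕ) (ℓ : ℕ → Fin K → ℝ) (hK : 2 ≤ K) (hT : 1 ≤ T)
    (hℓ : ∀ t i, 0 ≤ ℓ t i ∧ ℓ t i ≤ 1) :
    ExpCoop.welfareRegret G d ttl (1 / (T : ℝ)) ℓ T ≤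
      1000 * (√(Real.log K *
              (ExpCoop.meanDelay d + 1 + (K : ℝ) / Fintype.card V * ExpCoop.alphaP G d ttl *
                Real.log ((T : ℝ) * Fintype.card V * K)) * T)
          + ExpCoop.meanDelay d *
              (Real.log T + Real.log (Real.log ((T : ℝ) * Fintype.card V * K))))
        + 1000 * ((Fintype.card V : ℝ) + K + ∑ v, (d v : ℝ)) ^ 6 := by
  set S := (Fintype.card V : ℝ) + K + ∑ v, (d v : ℝ) with hS
  have hN : (1 : ℝ) ≤ Fintype.card V := by exact_mod_cast Fintype.card_pos
  have hsum : 0 ≤ ∑ v, (d v : ℝ) := by positivity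
  have hdS : ∀ v, (d v : ℝ) + 1 ≤ S := fun v => by
    linarith [Finset.single_le_sum (f := fun v => (d v : ℝ)) (fun u _ => (d u).cast_nonneg)
      (Finset.mem_univ v), K.cast_nonneg (α := ℝ)]
  have hS1 : S ≤ S ^ 6 := le_self_pow₀ (by linarith [K.cast_nonneg (α := ℝ)]) (by norm_num)
  have hmean := ExpCoop.meanDelay_nonneg d
  have hmeanS := ExpCoop.meanDelay_le_sum d
  have hlogT := mul_nonneg hmean (Real.log_natCast_nonneg T)
  have hlogT' := ExpCoop.log_le_four_mul_regretScale hK hT G d ttl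
  have hloglog := mul_le_mul_of_nonneg_left (ExpCoop.neg_log_two_le_log_log_horizon hK hT V) hmean
  have hregret := ExpCoop.welfareRegret_le (G := G) (ttl := ttl) hK hT hℓ (by linarith) hdS
  simp only [ExpCoop.regretScale] at hlogT' hregret
  linarith [hS, mul_le_mul_of_nonneg_left Real.log_two_lt_d9.le hmean, Real.log_natCast_nonneg T]

theorem corollaryc :
    ∃ (C : ℝ) (m : ℕ), 0 < C ∧
      ∀ (N K T : ℕ) (G : SimpleGraph (Fin N)) (d ttl : Fin N → ℕ) (ℓ : ℕ → Fin K → ℝ),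
        G.Connected → 2 ≤ K → 1 ≤ T → (∀ t i, 0 ≤ ℓ t i ∧ ℓ t i ≤ 1) →
        ExpCoop.welfareRegret G d ttl (1 / (T : ℝ)) ℓ T ≤
          C * (√(Real.log K *
                  (ExpCoop.meanDelay d + 1 +
                    (K : ℝ) / N * ExpCoop.alphaP G d ttl * Real.log ((T : ℝ) * N * K)) * T)
              + ExpCoop.meanDelay d *
                  (Real.log T + Real.log (Real.log ((T : ℝ) * N * K))))
            + C * ((N : ℝ) + K + ∑ v, (d v : ℝ)) ^ m := by
  refine ⟨1000, 6, by norm_num, fun N K T G d ttl ℓ hG hK hT hℓ => ?_⟩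
  have := hG.nonempty
  simpa only [Fintype.card_fin] using corollaryc_general G d ttl ℓ hK hT hℓ
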